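/- Let $K>0$ and $\varepsilon>0$ be real numbers. Let $N=N(n)\geq 0$ be integers with $N=o(n^{1/6})$ as $n\to\infty$. For all integers $1\leq i<j<\infty$ let $c_{ij},c'_{ij}$ be real numbers with $$-K\leq c_{ij}<c'_{ij}\leq K,\qquad \inf_{i<j}\,(c'_{ij}-c_{ij})\geq\varepsilon .$$ For $\mathbf u,\mathbf v\in S^{n-1}\subset\mathbb R^n$ let $a(\mathbf u,\mathbf v)\in[0,\pi]$ be the angle between them, let $\sigma_{n-1}$ be the uniform probability measure on $S^{n-1}$ and $\sigma_{n-1}^N$ its $N$-fold product, and put $$P(N)=\sigma_{n-1}^N\Big(\Big\{(\mathbf u_1,\dots,\mathbf u_N)\in (S^{n-1})^N : c_{ij}<\sqrt n\,\big(a(\mathbf u_i,\mathbf u_j)-\tfrac{\pi}{2}\big)\leq c'_{ij}\ \text{ for } 1\leq i<j\leq N\Big\}\Big).$$ Let $$G(N)=\Big(\frac1{\sqrt{2\pi}}\Big)^{\binom N2}\int_{[-K,K]^{\binom N2}}\ \prod_{1\leq i<j\leq N} \mathbf 1_{(c_{ij},c'_{ij}]}(t_{ij})\,e^{-t_{ij}^2/2}\,d\mathbf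 t ,$$ which is the probability that independent standard Gaussians $X_{ij}$ $(1\leq i<j\leq N)$ satisfy $c_{ij}<X_{ij}\leq c'_{ij}$ for all $i<j\leq N$. Then, as $n\to\infty$, $$\frac{P(N)}{G(N)}=1+O_{K,\varepsilon}\Big(\frac{N^3}{\sqrt n}\Big).$$ That is, there is a constant $C$ depending only on $K$ and $\varepsilon$ such that for every such sequence $N(n)$ there is an $n_0$, depending only on $K$, $\varepsilon$ and the sequence $N(n)$, such that for all $n\geq n_0$ and all families $(c_{ij}),(c'_{ij})$ as above, $\left|P(N)/G(N)-1\right|\leq C\,N^3/\sqrt n$. -/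

import Mathlib

open MeasureTheory ProbabilityTheory Filter Asymptotics

namespace SphereAngles

noncomputable section

/-- The sphere `S^{n-1}`, as the unit sphere of Euclidean `n`-space. -/
abbrev Sph (n : ℕ) : Type := Metric.sphere (0 : EuclideanSpace ℝ (Fin n)) 1

/-- The uniform probability measure on `S^{n-1}`: the normalized surface measure. -/
def sphereProb (n : ℕ) : Measure (Sph n) :=
  ((volume : Measure (EuclideanSpace ℝ (Fin n))).toSphere Set.univ)⁻¹ •
    (volume : Measure (EuclideanSpace ℝ (Fin n))).toSphere

/-- The normalized angle `√n (a(u, v) - π / 2)` with `a(u, v) ∈ [0, π]`. -/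
def normAngle (n : ℕ) (u v : Sph n) : ℝ :=
  √(n : ℝ) * (InnerProductGeometry.angle (u : EuclideanSpace ℝ (Fin n)) v - Real.pi / 2)

/-- `P(N)`: the probability that the normalized angles of `N` independent uniform points of
`S^{n-1}` all satisfy `c i j < √n (a(u_i, u_j) - π / 2) ≤ c' i j` (`i < j`, indices from `0`). -/
def angleProb (n N : ℕ) (c c' : ℕ → ℕ → ℝ) : ℝ :=
  (Measure.pi fun _ : Fin N => sphereProb n).real
    {u | ∀ i j : Fin N, i < j →
      c i j < normAngle n (u i) (u j) ∧ normAngle n (u i) (u j) ≤ c' i j}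

/-- The admissible pairs `i < j`. -/
abbrev Pairs (N : ℕ) : Type := {p : Fin N × Fin N // p.1 < p.2}

/-- `G(N)`: the integral over `[-K, K]^{N choose 2}` of the standard Gaussian density restricted to
the box given by `c i j < t i j ≤ c' i j`. -/
def gaussProb (K : ℝ) (N : ℕ) (c c' : ℕ → ℕ → ℝ) : ℝ :=
  (1 / √(2 * Real.pi)) ^ N.choose 2 *
    ∫ t : Pairs N → ℝ in Set.univ.pi fun _ => Set.Icc (-K) K,
      ∏ p : Pairs N, (Set.Ioc (c p.1.1 p.1.2) (c' p.1.1 p.1.2)).indicator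
        (fun s => Real.exp (-s ^ 2 / 2)) (t p)

/-- `sphereProb n` is a probability measure in positive dimension. -/
instance isProbabilityMeasure_sphereProb (n : ℕ) [NeZero n] :
    IsProbabilityMeasure (sphereProb n) := by
  constructor
  have h : (volume : Measure (EuclideanSpace ℝ (Fin n))).toSphere Set.univ ≠ 0 := by
    rw [Ne, Measure.measure_univ_eq_zero, Measure.toSphere_eq_zero_iff_finrank,
      finrank_euclideanSpace_fin]
    exact NeZero.ne n
  simp only [sphereProb, Measure.smul_apply, smul_eq_mul]
  exact ENNReal.inv_mul_cancel h (measure_ne_top _ _)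

theorem card_pairs (N : ℕ) : Fintype.card (Pairs N) = N.choose 2 := by
  rw [Fintype.card_subtype, Fintype.card_product_filter_lt, Fintype.card_fin]

/-- `G(N)` is the probability that independent standard Gaussians lie in the boxes. -/
theorem gaussProb_eq (K : ℝ) (N : ℕ) (c c' : ℕ → ℕ → ℝ)
    (h : ∀ i j, i < j → -K ≤ c i j ∧ c' i j ≤ K) :
    gaussProb K N c c' = (Measure.pi fun _ : Pairs N => gaussianReal 0 1).real
      (Set.univ.pi fun p => Set.Ioc (c p.1.1 p.1.2) (c' p.1.1 p.1.2)) := by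
  rw [gaussProb, volume_pi, Measure.restrict_pi_pi, integral_fintype_prod_eq_prod,
    ← card_pairs, ← Finset.card_univ, ← Finset.prod_const, ← Finset.prod_mul_distrib,
    measureReal_def, Measure.pi_pi, ENNReal.toReal_prod]
  refine Finset.prod_congr rfl fun p _ => ?_
  obtain ⟨h1, h2⟩ := h p.1.1 p.1.2 p.2
  have hs : Set.Ioc (c p.1.1 p.1.2) (c' p.1.1 p.1.2) ⊆ Set.Icc (-K) K := fun x hx =>
    ⟨h1.trans hx.1.le, hx.2.trans h2⟩
  rw [gaussianReal_apply_eq_integral 0 one_ne_zero, ENNReal.toReal_ofReal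
    (integral_nonneg fun x => gaussianPDFReal_nonneg _ _ _),
    integral_indicator measurableSet_Ioc, Measure.restrict_restrict measurableSet_Ioc,
    Set.inter_eq_left.2 hs, ← integral_const_mul]
  simp [gaussianPDFReal]

end

end SphereAngles

/-!
The points are exposed one at a time. If `u_1, …, u_k` are given and their normalized angles lie in
`[-K, K]`, then their Gram matrix `G` has unit diagonal and off-diagonal entries at most `K / √n`,
and it is enough to show that a further uniform point `u` meets its `k` angle constraints with
probability `exp (± C k² / √n)` times the Gaussian probability of the box
(`exists_conditional_bounds`). Multiplying over `k < N` gives the factor `exp (± C N³ / √n)`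
(`exists_angleProb_bounds`), and `N³ / √n → 0` turns it into `1 + O(N³ / √n)`.

For the conditional statement choose an orthonormal basis whose first `k` vectors span a space
containing the `u_i`, and write `u = (y, z)` accordingly, so that `⟨-u_i, u⟩ = (A y)_i` with
`A Aᵀ = G`. The statistic `T = √n A y / |z|` is homogeneous of degree `0`, so its law does not change
when `u` is replaced by a standard Gaussian vector. For fixed `z` the substitution from `y` to `T` is
linear, hence no nonlinear Jacobian appears, and integrating out `z` gives the density
`|det A|⁻¹ (nπ)^(-k/2) Γ(n/2) / Γ((n-k)/2) (1 + |A⁻¹ t|² / n)^(-n/2)` (`sphereProb_quotient`). On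
bounded boxes each factor is compared with the standard Gaussian density up to
`exp (O(k² / √n))` (`quotient_density_bounds`): `det A` by Gershgorin's theorem, `|A⁻¹ t|²` by solving
`G w = t`, the Gamma quotient by log-convexity.

Finally, the normalized angle to `u_i` is `√n arcsin (A y)_i`, which differs from `T_i` by `O(k / n)`
on the events in question (`abs_quotient_sub_arcsin_le`). The event is therefore sandwiched between
two box events for `T`, and moving the faces of the boxes by `O(k / n)` costs a factor
`exp (O(k / n))` in each coordinate, because every side has length at least `ε`.
-/

/-! ### Matrices close to the identity -/

open Matrix in
/-- Gershgorin's theorem for a symmetric matrix with unit diagonal and small off-diagonal entries. -/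
theorem abs_eigenvalue_sub_one_le {k : ℕ} {G : Matrix (Fin k) (Fin k) ℝ} {β : ℝ} (hβ : 0 ≤ β)
    (hG : G.IsHermitian) (hdiag : ∀ i, G i i = 1) (hoff : ∀ i j, i ≠ j → |G i j| ≤ β)
    (i : Fin k) : |hG.eigenvalues i - 1| ≤ k * β := by
  have h1 : Module.End.HasEigenvalue (Matrix.toLin' G) (hG.eigenvalues i) := by
    rw [Module.End.hasEigenvalue_iff, Submodule.ne_bot_iff]
    refine ⟨(hG.eigenvectorBasis i).ofLp, ?_, ?_⟩
    · rw [Module.End.mem_eigenspace_iff, Matrix.toLin'_apply]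
      exact hG.mulVec_eigenvectorBasis i
    · intro h
      have := hG.eigenvectorBasis.orthonormal.ne_zero i
      exact this (by ext j; simpa using congrFun h j)
  obtain ⟨l, hl⟩ := eigenvalue_mem_ball h1
  rw [Metric.mem_closedBall, Real.dist_eq, hdiag] at hl
  refine hl.trans ?_
  calc ∑ j ∈ Finset.univ.erase l, ‖G l j‖ ≤ ∑ j ∈ Finset.univ.erase l, β :=
        Finset.sum_le_sum fun j hj => hoff l j (Finset.ne_of_mem_erase hj).symm
    _ ≤ ∑ j : Fin k, β := Finset.sum_le_sum_of_subset_of_nonneg (Finset.erase_subset _ _)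
        fun _ _ _ => hβ
    _ = k * β := by simp

theorem exp_neg_two_mul_le_one_sub {x : ℝ} (h0 : 0 ≤ x) (h1 : x ≤ 1 / 2) :
    Real.exp (-(2 * x)) ≤ 1 - x := by
  rw [Real.exp_neg, inv_le_comm₀ (Real.exp_pos _) (by linarith)]
  calc (1 - x)⁻¹ ≤ 2 * x + 1 := by
        rw [inv_le_iff_one_le_mul₀ (by linarith)]; nlinarith
    _ ≤ _ := Real.add_one_le_exp _

theorem det_bounds_of_near_one {k : ℕ} {G : Matrix (Fin k) (Fin k) ℝ} {β : ℝ} (hβ : 0 ≤ β)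
    (hkβ : k * β ≤ 1 / 2)
    (hG : G.IsHermitian) (hdiag : ∀ i, G i i = 1) (hoff : ∀ i j, i ≠ j → |G i j| ≤ β) :
    Real.exp (-(2 * (k ^ 2 * β))) ≤ G.det ∧ G.det ≤ Real.exp (2 * (k ^ 2 * β)) := by
  have hk0 : 0 ≤ k * β := by positivity
  have hb := fun i => abs_le.1 (abs_eigenvalue_sub_one_le hβ hG hdiag hoff i)
  have hl : ∀ i, Real.exp (-(2 * (k * β))) ≤ hG.eigenvalues i := fun i =>
    (exp_neg_two_mul_le_one_sub hk0 hkβ).trans (by linarith [(hb i).1])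
  have hu : ∀ i, hG.eigenvalues i ≤ Real.exp (2 * (k * β)) := fun i =>
    (by linarith [(hb i).2] : _ ≤ 2 * (k * β) + 1).trans (Real.add_one_le_exp _)
  have hdet : G.det = ∏ i, hG.eigenvalues i := by simpa using hG.det_eq_prod_eigenvalues
  rw [hdet]
  constructor
  · calc Real.exp (-(2 * (k ^ 2 * β))) = ∏ _i : Fin k, Real.exp (-(2 * (k * β))) := by
          rw [Finset.prod_const, Finset.card_univ, Fintype.card_fin, ← Real.exp_nat_mul]
          ring_nf
      _ ≤ _ := Finset.prod_le_prod (fun _ _ => (Real.exp_pos _).le) fun i _ => hl i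
  · calc ∏ i, hG.eigenvalues i ≤ ∏ _i : Fin k, Real.exp (2 * (k * β)) :=
          Finset.prod_le_prod (fun i _ => (Real.exp_pos _).le.trans (hl i)) fun i _ => hu i
      _ = _ := by
          rw [Finset.prod_const, Finset.card_univ, Fintype.card_fin, ← Real.exp_nat_mul]
          ring_nf

open Matrix in
/-- `|A⁻¹ t|²` is close to `|t|²` when `A Aᵀ` is close to the identity. With `w` the solution of
`A Aᵀ w = t`, one has `|A⁻¹ t|² = t ⬝ w`, and `w` is close to `t` in the sup norm. -/
theorem abs_dotProduct_self_sub_le {k : ℕ} {A : Matrix (Fin k) (Fin k) ℝ} {β R : ℝ} (hβ : 0 ≤ β)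
    (hR : 0 ≤ R) (hkβ : k * β ≤ 1 / 2) (hA : IsUnit A.det)
    (hdiag : ∀ i, (A * Aᵀ) i i = 1) (hoff : ∀ i j, i ≠ j → |(A * Aᵀ) i j| ≤ β)
    {y t : Fin k → ℝ} (hy : A *ᵥ y = t) (ht : ∀ i, |t i| ≤ R) :
    |y ⬝ᵥ y - t ⬝ᵥ t| ≤ 2 * k ^ 2 * β * R ^ 2 := by
  obtain ⟨w, hw⟩ : ∃ w, Aᵀ *ᵥ w = y := by
    refine ⟨(Aᵀ)⁻¹ *ᵥ y, ?_⟩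
    rw [mulVec_mulVec, mul_nonsing_inv _ (by rwa [det_transpose]), one_mulVec]
  set G := A * Aᵀ with hGdef
  have hGw : G *ᵥ w = t := by rw [hGdef, ← mulVec_mulVec, hw, hy]
  have hyy : y ⬝ᵥ y = t ⬝ᵥ w := by
    rw [← hy, dotProduct_comm (A *ᵥ y) w, dotProduct_mulVec, ← mulVec_transpose, hw]
  have hrow : ∀ i, t i - w i = ∑ j ∈ Finset.univ.erase i, G i j * w j := by
    intro i
    rw [← hGw, mulVec, dotProduct, ← Finset.add_sum_erase _ _ (Finset.mem_univ i), hdiag]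
    ring
  have hbd : ∀ M : ℝ, 0 ≤ M → (∀ j, |w j| ≤ M) → ∀ i, |t i - w i| ≤ k * (β * M) := by
    intro M hM hw i
    rw [hrow]
    calc |∑ j ∈ Finset.univ.erase i, G i j * w j|
        ≤ ∑ j ∈ Finset.univ.erase i, |G i j * w j| := Finset.abs_sum_le_sum_abs _ _
      _ ≤ ∑ j ∈ Finset.univ.erase i, β * M := by
          refine Finset.sum_le_sum fun j hj => ?_
          rw [abs_mul]
          exact mul_le_mul (hoff i j (Finset.ne_of_mem_erase hj).symm) (hw j) (abs_nonneg _) hβ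
      _ ≤ ∑ j : Fin k, β * M := Finset.sum_le_sum_of_subset_of_nonneg (Finset.erase_subset _ _)
          fun _ _ _ => by positivity
      _ = k * (β * M) := by simp
  -- At an index where `|w i|` is maximal, `|w i| ≤ R + |w i| / 2`.
  have hw2 : ∀ j, |w j| ≤ 2 * R := by
    intro j
    obtain ⟨i, -, hi⟩ := Finset.exists_max_image Finset.univ (fun i => |w i|) ⟨j, Finset.mem_univ j⟩
    have h := hbd |w i| (abs_nonneg _) (fun l => hi l (Finset.mem_univ l)) i
    have h2 : |w i| ≤ |t i| + |t i - w i| := by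
      have := abs_sub_abs_le_abs_sub (w i) (t i)
      rw [abs_sub_comm] at this; linarith
    have h3 := mul_le_mul_of_nonneg_right hkβ (abs_nonneg (w i))
    have := hi j (Finset.mem_univ j)
    have := ht i
    linarith
  have hfin := hbd (2 * R) (by positivity) hw2
  have : y ⬝ᵥ y - t ⬝ᵥ t = - ∑ i, t i * (t i - w i) := by
    rw [hyy]; simp only [dotProduct, ← Finset.sum_sub_distrib, ← Finset.sum_neg_distrib]
    exact Finset.sum_congr rfl fun i _ => by ring
  rw [this, abs_neg]
  calc |∑ i, t i * (t i - w i)| ≤ ∑ i, |t i * (t i - w i)| := Finset.abs_sum_le_sum_abs _ _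
    _ ≤ ∑ _i : Fin k, R * (k * (β * (2 * R))) := by
        refine Finset.sum_le_sum fun i _ => ?_
        rw [abs_mul]
        exact mul_le_mul (ht i) (hfin i) (abs_nonneg _) hR
    _ = _ := by simp; ring

/-! ### Polar coordinates and Gaussian integrals -/

/-- Polar coordinates: the integral of a radial function over a cone `S` factors into the surface
measure of `S` and a radial integral. -/
theorem setLIntegral_norm_of_cone {E : Type*} [NormedAddCommGroup E] [NormedSpace ℝ E]
    [MeasurableSpace E] [BorelSpace E] [FiniteDimensional ℝ E] [Nontrivial E] (μ : Measure E)
    [μ.IsAddHaarMeasure] {S : Set E} (hS : MeasurableSet S)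
    (hcone : ∀ r : ℝ, 0 < r → ∀ x, r • x ∈ S ↔ x ∈ S) {f : ℝ → ENNReal} (hf : Measurable f) :
    ∫⁻ x in S, f ‖x‖ ∂μ = μ.toSphere {u | (u : E) ∈ S} *
      ∫⁻ r : Set.Ioi (0 : ℝ), f r ∂(Measure.volumeIoiPow (Module.finrank ℝ E - 1)) := by
  have hS' : MeasurableSet {u : Metric.sphere (0 : E) 1 | (u : E) ∈ S} :=
    measurable_subtype_coe hS
  rw [← lintegral_indicator hS]
  calc ∫⁻ x : E, S.indicator (fun x => f ‖x‖) x ∂μ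
      = ∫⁻ x : ({(0)}ᶜ : Set E), S.indicator (fun x => f ‖x‖) x ∂(μ.comap Subtype.val) := by
        rw [lintegral_subtype_comap (measurableSet_singleton _).compl,
          restrict_compl_singleton]
    _ = ∫⁻ x : ({(0)}ᶜ : Set E),
          (fun p : Metric.sphere (0 : E) 1 × Set.Ioi (0 : ℝ) =>
            {u : Metric.sphere (0 : E) 1 | (u : E) ∈ S}.indicator 1 p.1 * f p.2)
            (homeomorphUnitSphereProd E x) ∂(μ.comap Subtype.val) := by
        refine lintegral_congr fun x => ?_
        have hx : (0 : ℝ) < ‖(x : E)‖⁻¹ := inv_pos.2 (norm_pos_iff.2 x.2)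
        have h := hcone _ hx x
        simp only [homeomorphUnitSphereProd_apply_snd_coe]
        by_cases hxS : (x : E) ∈ S
        · rw [Set.indicator_of_mem hxS, Set.indicator_of_mem]
          · simp
          · simpa [homeomorphUnitSphereProd_apply_fst_coe] using h.2 hxS
        · rw [Set.indicator_of_notMem hxS, Set.indicator_of_notMem]
          · simp
          · simpa [homeomorphUnitSphereProd_apply_fst_coe] using fun h' => hxS (h.1 h')
    _ = ∫⁻ p : Metric.sphere (0 : E) 1 × Set.Ioi (0 : ℝ),
          {u : Metric.sphere (0 : E) 1 | (u : E) ∈ S}.indicator 1 p.1 * f p.2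
            ∂(μ.toSphere.prod (.volumeIoiPow (Module.finrank ℝ E - 1))) :=
        μ.measurePreserving_homeomorphUnitSphereProd.lintegral_comp_emb
          (Homeomorph.measurableEmbedding _) (fun p : Metric.sphere (0 : E) 1 × Set.Ioi (0 : ℝ) =>
            {u : Metric.sphere (0 : E) 1 | (u : E) ∈ S}.indicator 1 p.1 * f p.2)
    _ = _ := by
        rw [lintegral_prod_mul (g := fun r : Set.Ioi (0 : ℝ) => f r)
          (measurable_one.indicator hS').aemeasurable
          (hf.comp measurable_subtype_coe).aemeasurable, lintegral_indicator_one hS']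

/-- The uniform probability of a cone is the proportion of any radial weight that it carries. -/
theorem sphereProb_mul_lintegral_norm (n : ℕ) [NeZero n] {S : Set (EuclideanSpace ℝ (Fin n))}
    (hS : MeasurableSet S) (hcone : ∀ r : ℝ, 0 < r → ∀ x, r • x ∈ S ↔ x ∈ S)
    {f : ℝ → ENNReal} (hf : Measurable f) :
    SphereAngles.sphereProb n {u | (u : EuclideanSpace ℝ (Fin n)) ∈ S} *
      ∫⁻ x : EuclideanSpace ℝ (Fin n), f ‖x‖ = ∫⁻ x in S, f ‖x‖ := by
  have : Nontrivial (EuclideanSpace ℝ (Fin n)) :=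
    Module.nontrivial_of_finrank_pos (R := ℝ) (by simpa using Nat.pos_of_ne_zero (NeZero.ne n))
  rw [setLIntegral_norm_of_cone volume hS hcone hf, ← setLIntegral_univ,
    setLIntegral_norm_of_cone volume .univ (by simp) hf]
  simp only [Set.mem_univ, Set.ofPred_true]
  rw [SphereAngles.sphereProb, Measure.smul_apply, smul_eq_mul]
  rw [← mul_assoc, mul_right_comm _ _ ((volume : Measure _).toSphere Set.univ),
    ENNReal.inv_mul_cancel 
    (Measure.measure_univ_ne_zero.2 (Measure.toSphere_ne_zero _)) (measure_ne_top _ _),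
    one_mul]

theorem lintegral_norm_pow_mul_exp (k m : ℕ) [NeZero m] {b : ℝ} (hb : 0 < b) :
    ∫⁻ z : EuclideanSpace ℝ (Fin m), ENNReal.ofReal (‖z‖ ^ k * Real.exp (-b * ‖z‖ ^ 2)) =
      ENNReal.ofReal (Real.pi ^ ((m : ℝ) / 2) * (Real.Gamma (((k + m : ℕ) : ℝ) / 2) /
        Real.Gamma ((m : ℝ) / 2)) * b ^ (-((k + m : ℕ) : ℝ) / 2)) := by
  have hm : 0 < m := Nat.pos_of_ne_zero (NeZero.ne m)
  have : Nontrivial (EuclideanSpace ℝ (Fin m)) :=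
    Module.nontrivial_of_finrank_pos (R := ℝ) (by simpa using hm)
  have hq : (-1 : ℝ) < ((k + m - 1 : ℕ) : ℝ) := by
    have : (0 : ℝ) ≤ ((k + m - 1 : ℕ) : ℝ) := by positivity
    linarith
  have hfun : ∀ x ∈ Set.Ioi (0 : ℝ),
      x ^ ((k + m - 1 : ℕ) : ℝ) * Real.exp (-b * x ^ (2 : ℝ)) =
      x ^ (Module.finrank ℝ (EuclideanSpace ℝ (Fin m)) - 1) • (x ^ k * Real.exp (-b * x ^ 2)) := by
    intro x _
    rw [finrank_euclideanSpace_fin, Real.rpow_natCast, smul_eq_mul, ← mul_assoc, ← pow_add]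
    congr 2
    · omega
    · norm_cast
  have hint : Integrable
      (fun z : EuclideanSpace ℝ (Fin m) => ‖z‖ ^ k * Real.exp (-b * ‖z‖ ^ 2)) := by
    rw [integrable_fun_norm_addHaar volume (f := fun x => x ^ k * Real.exp (-b * x ^ 2))]
    refine (integrableOn_congr_fun hfun measurableSet_Ioi).1 ?_
    exact integrableOn_rpow_mul_exp_neg_mul_rpow hq two_pos hb
  rw [← ofReal_integral_eq_lintegral_ofReal hint (.of_forall fun z => by positivity)]
  congr 1
  rw [integral_fun_norm_addHaar volume (fun x => x ^ k * Real.exp (-b * x ^ 2)),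
    ← setIntegral_congr_fun measurableSet_Ioi hfun,
    integral_rpow_mul_exp_neg_mul_rpow two_pos hq hb, finrank_euclideanSpace_fin,
    measureReal_def, InnerProductSpace.volume_ball, finrank_euclideanSpace_fin]
  have hkm : ((k + m - 1 : ℕ) : ℝ) + 1 = ((k + m : ℕ) : ℝ) := by
    rw [← Nat.cast_add_one]; congr 1; omega
  have hm' : (0 : ℝ) < (m : ℝ) / 2 := by positivity
  have hG : 0 < Real.Gamma ((m : ℝ) / 2) := Real.Gamma_pos_of_pos hm'
  have hpi : √Real.pi ^ m = Real.pi ^ ((m : ℝ) / 2) := by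
    rw [Real.sqrt_eq_rpow, ← Real.rpow_natCast, ← Real.rpow_mul Real.pi_pos.le]
    congr 1; ring
  rw [hkm, Real.Gamma_add_one hm'.ne', hpi]
  simp only [ENNReal.ofReal_one, one_pow, one_mul]
  rw [ENNReal.toReal_ofReal (by positivity)]
  simp only [smul_eq_mul, nsmul_eq_mul]
  field_simp

open Matrix in
/-- Linear change of variables `t = M y`. -/
theorem lintegral_indicator_mulVec {k : ℕ} {M : Matrix (Fin k) (Fin k) ℝ} (hM : M.det ≠ 0)
    {B : Set (Fin k → ℝ)} (hB : MeasurableSet B) {f : (Fin k → ℝ) → ENNReal} (hf : Measurable f) :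
    ∫⁻ y, B.indicator 1 (M *ᵥ y) * f y =
      ENNReal.ofReal |M.det⁻¹| * ∫⁻ t in B, f (M⁻¹ *ᵥ t) := by
  have hmeas : ∀ N : Matrix (Fin k) (Fin k) ℝ, Measurable fun y => N *ᵥ y := fun N =>
    (Continuous.matrix_mulVec continuous_const continuous_id).measurable
  have h := Real.map_matrix_volume_pi_eq_smul_volume_pi hM
  rw [← lintegral_indicator hB, ← smul_eq_mul, ← lintegral_smul_measure, ← h,
    lintegral_map (f := B.indicator fun t => f (M⁻¹ *ᵥ t)) ((hf.comp (hmeas _)).indicator hB)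
      (by simpa only [← Matrix.toLin'_apply] using hmeas M)]
  refine lintegral_congr fun y => ?_
  rw [Matrix.toLin'_apply]
  by_cases hy : M *ᵥ y ∈ B
  · rw [Set.indicator_of_mem hy, Set.indicator_of_mem hy, mulVec_mulVec,
      nonsing_inv_mul _ (isUnit_iff_ne_zero.2 hM), one_mulVec, Pi.one_apply, one_mul]
  · rw [Set.indicator_of_notMem hy, Set.indicator_of_notMem hy, zero_mul]

open Matrix in
/-- The Gaussian integral over `{A y / |z| ∈ B}`: for fixed `z` substitute `y = |z| A⁻¹ t`, then
integrate over `z` first. -/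
theorem lintegral_gaussian_quotient {k m : ℕ} [NeZero m] {A : Matrix (Fin k) (Fin k) ℝ}
    (hA : A.det ≠ 0) {B : Set (Fin k → ℝ)} (hB : MeasurableSet B) :
    ∫⁻ p : (Fin k → ℝ) × EuclideanSpace ℝ (Fin m),
      B.indicator 1 (‖p.2‖⁻¹ • A *ᵥ p.1) *
        ENNReal.ofReal (Real.exp (-(1 / 2) * (p.1 ⬝ᵥ p.1 + ‖p.2‖ ^ 2))) =
    ∫⁻ t in B, ENNReal.ofReal (|A.det|⁻¹ * (Real.pi ^ ((m : ℝ) / 2) *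
      (Real.Gamma (((k + m : ℕ) : ℝ) / 2) / Real.Gamma ((m : ℝ) / 2)) *
      ((1 + A⁻¹ *ᵥ t ⬝ᵥ A⁻¹ *ᵥ t) / 2) ^ (-((k + m : ℕ) : ℝ) / 2))) := by
  have hmeas : ∀ N : Matrix (Fin k) (Fin k) ℝ, Measurable fun y => N *ᵥ y := fun N =>
    (Continuous.matrix_mulVec continuous_const continuous_id).measurable
  have hdot : Measurable fun y : Fin k → ℝ => y ⬝ᵥ y :=
    (Continuous.dotProduct continuous_id continuous_id).measurable
  have hm : 0 < m := Nat.pos_of_ne_zero (NeZero.ne m)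
  have : Nontrivial (EuclideanSpace ℝ (Fin m)) :=
    Module.nontrivial_of_finrank_pos (R := ℝ) (by simpa using hm)
  have h1 : Measurable fun p : (Fin k → ℝ) × EuclideanSpace ℝ (Fin m) =>
      B.indicator (1 : (Fin k → ℝ) → ENNReal) (‖p.2‖⁻¹ • A *ᵥ p.1) *
        ENNReal.ofReal (Real.exp (-(1 / 2) * (p.1 ⬝ᵥ p.1 + ‖p.2‖ ^ 2))) := by
    refine Measurable.mul ((measurable_one.indicator hB).comp ?_) ?_
    · exact (measurable_snd.norm.inv).smul ((hmeas A).comp measurable_fst)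
    · exact ((((hdot.comp measurable_fst).add (measurable_snd.norm.pow_const 2)).const_mul
        _).exp).ennreal_ofReal
  rw [Measure.volume_eq_prod, lintegral_prod_symm _ h1.aemeasurable]
  have h2 : ∀ z : EuclideanSpace ℝ (Fin m), z ≠ 0 →
      ∫⁻ y : Fin k → ℝ, B.indicator 1 (‖z‖⁻¹ • A *ᵥ y) *
        ENNReal.ofReal (Real.exp (-(1 / 2) * (y ⬝ᵥ y + ‖z‖ ^ 2))) =
      ∫⁻ t in B, ENNReal.ofReal |A.det|⁻¹ * ENNReal.ofReal (‖z‖ ^ k *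
        Real.exp (-((1 + A⁻¹ *ᵥ t ⬝ᵥ A⁻¹ *ᵥ t) / 2) * ‖z‖ ^ 2)) := by
    intro z hz
    have hz' : 0 < ‖z‖ := norm_pos_iff.2 hz
    have hdet : (‖z‖⁻¹ • A).det = (‖z‖ ^ k)⁻¹ * A.det := by simp
    have hM : (‖z‖⁻¹ • A).det ≠ 0 := by rw [hdet]; positivity
    have hinv : (‖z‖⁻¹ • A)⁻¹ = ‖z‖ • A⁻¹ := by
      apply inv_eq_right_inv
      rw [smul_mul_smul_comm, inv_mul_cancel₀ hz'.ne', one_smul,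
        mul_nonsing_inv _ (isUnit_iff_ne_zero.2 hA)]
    have := lintegral_indicator_mulVec hM hB (f := fun y =>
      ENNReal.ofReal (Real.exp (-(1 / 2) * (y ⬝ᵥ y + ‖z‖ ^ 2)))) (by fun_prop)
    simp only [smul_mulVec] at this
    rw [this, ← lintegral_const_mul' _ _ ENNReal.ofReal_ne_top]
    refine setLIntegral_congr_fun hB fun t _ => ?_
    rw [hinv, smul_mulVec, ← ENNReal.ofReal_mul (abs_nonneg _),
      ← ENNReal.ofReal_mul (by positivity), hdet, mul_inv, inv_inv, abs_mul, abs_inv,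
      abs_of_pos (by positivity : 0 < ‖z‖ ^ k), smul_dotProduct, dotProduct_smul]
    congr 1
    rw [smul_eq_mul, smul_eq_mul, mul_comm (‖z‖ ^ k), mul_assoc]
    congr 3
    ring
  have hae : ∀ᵐ z : EuclideanSpace ℝ (Fin m), z ≠ 0 := by
    simp [ae_iff]
  rw [lintegral_congr_ae (hae.mono h2), lintegral_lintegral_swap]
  · refine setLIntegral_congr_fun hB fun t _ => ?_
    have hpos : 0 < (1 + A⁻¹ *ᵥ t ⬝ᵥ A⁻¹ *ᵥ t) / 2 := by
      have : 0 ≤ A⁻¹ *ᵥ t ⬝ᵥ A⁻¹ *ᵥ t := Finset.sum_nonneg fun i _ => mul_self_nonneg _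
      positivity
    rw [lintegral_const_mul' _ _ ENNReal.ofReal_ne_top, lintegral_norm_pow_mul_exp k m hpos,
      ← ENNReal.ofReal_mul (by positivity)]
  · refine Measurable.aemeasurable ?_
    refine Measurable.const_mul (Measurable.ennreal_ofReal ?_) _
    refine (measurable_fst.norm.pow_const k).mul (Measurable.exp ?_)
    refine Measurable.mul ?_ (measurable_fst.norm.pow_const 2)
    exact ((measurable_const.add ((hdot.comp (hmeas A⁻¹)).comp measurable_snd)).div_const 2).neg

/-! ### The density of the tangent coordinates of a uniform point of the sphere -/

/-- The coordinates of a vector along the two blocks of an orthonormal basis. The first block is a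
plain function, acted on by matrices; the second carries the Euclidean norm. -/
noncomputable def blockCoords {n k m : ℕ}
    (b : OrthonormalBasis (Fin k ⊕ Fin m) ℝ (EuclideanSpace ℝ (Fin n)))
    (x : EuclideanSpace ℝ (Fin n)) : (Fin k → ℝ) × EuclideanSpace ℝ (Fin m) :=
  (fun i => b.repr x (Sum.inl i), WithLp.toLp 2 fun j => b.repr x (Sum.inr j))

theorem measurePreserving_blockCoords {n k m : ℕ}
    (b : OrthonormalBasis (Fin k ⊕ Fin m) ℝ (EuclideanSpace ℝ (Fin n))) :
    MeasurePreserving (blockCoords b) := by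
  have h1 := (PiLp.volume_preserving_ofLp (Fin k ⊕ Fin m)).comp b.measurePreserving_repr
  have h2 := (volume_measurePreserving_sumPiEquivProdPi (fun _ : Fin k ⊕ Fin m => ℝ)).comp h1
  exact ((MeasurePreserving.id volume).prod (PiLp.volume_preserving_toLp (Fin m))).comp h2

open Matrix in
theorem norm_sq_eq_blockCoords {n k m : ℕ}
    (b : OrthonormalBasis (Fin k ⊕ Fin m) ℝ (EuclideanSpace ℝ (Fin n)))
    (x : EuclideanSpace ℝ (Fin n)) :
    ‖x‖ ^ 2 = (blockCoords b x).1 ⬝ᵥ (blockCoords b x).1 + ‖(blockCoords b x).2‖ ^ 2 := by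
  rw [← b.repr.norm_map x, EuclideanSpace.real_norm_sq_eq, EuclideanSpace.real_norm_sq_eq,
    Fintype.sum_sum_type]
  simp [blockCoords, dotProduct, sq]

theorem blockCoords_smul {n k m : ℕ}
    (b : OrthonormalBasis (Fin k ⊕ Fin m) ℝ (EuclideanSpace ℝ (Fin n))) (r : ℝ)
    (x : EuclideanSpace ℝ (Fin n)) : blockCoords b (r • x) = r • blockCoords b x := by
  ext i <;> simp [blockCoords]

open Matrix in
/-- The law of `A y / |z|` for a uniform point `(y, z)` of the sphere has a multivariate Student
density. -/
theorem sphereProb_quotient {n k m : ℕ} [NeZero n] [NeZero m] (hn : n = k + m)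
    (b : OrthonormalBasis (Fin k ⊕ Fin m) ℝ (EuclideanSpace ℝ (Fin n)))
    {A : Matrix (Fin k) (Fin k) ℝ} (hA : A.det ≠ 0)
    {B : Set (Fin k → ℝ)} (hB : MeasurableSet B) :
    SphereAngles.sphereProb n
      {u | ‖(blockCoords b u).2‖⁻¹ • A *ᵥ (blockCoords b u).1 ∈ B} =
    ∫⁻ t in B, ENNReal.ofReal (|A.det|⁻¹ * (Real.pi ^ (-(k : ℝ) / 2) *
      (Real.Gamma ((n : ℝ) / 2) / Real.Gamma ((m : ℝ) / 2)) *
      (1 + A⁻¹ *ᵥ t ⬝ᵥ A⁻¹ *ᵥ t) ^ (-(n : ℝ) / 2))) := by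
  set S : Set (EuclideanSpace ℝ (Fin n)) :=
    {x | ‖(blockCoords b x).2‖⁻¹ • A *ᵥ (blockCoords b x).1 ∈ B} with hSdef
  have hT : Measurable fun p : (Fin k → ℝ) × EuclideanSpace ℝ (Fin m) => ‖p.2‖⁻¹ • A *ᵥ p.1 :=
    (measurable_snd.norm.inv).smul
      ((Continuous.matrix_mulVec continuous_const continuous_id).measurable.comp measurable_fst)
  have hb := measurePreserving_blockCoords b
  have hS : MeasurableSet S := (hT.comp hb.measurable) hB
  have hcone : ∀ r : ℝ, 0 < r → ∀ x, r • x ∈ S ↔ x ∈ S := by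
    intro r hr x
    simp only [hSdef, Set.mem_ofPred_eq, blockCoords_smul, Prod.smul_fst, Prod.smul_snd,
      norm_smul, mulVec_smul, Real.norm_of_nonneg hr.le, mul_inv, smul_smul]
    rw [mul_right_comm, inv_mul_cancel₀ hr.ne', one_mul]
  have hpolar := sphereProb_mul_lintegral_norm n hS hcone
    (f := fun r => ENNReal.ofReal (Real.exp (-(1 / 2) * r ^ 2))) (by fun_prop)
  have htot : ∫⁻ x : EuclideanSpace ℝ (Fin n), ENNReal.ofReal (Real.exp (-(1 / 2) * ‖x‖ ^ 2)) =
      ENNReal.ofReal ((2 * Real.pi) ^ ((n : ℝ) / 2)) := by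
    have := lintegral_norm_pow_mul_exp 0 n (b := 1 / 2) (by norm_num)
    simp only [pow_zero, one_mul, zero_add] at this
    rw [this, div_self (Real.Gamma_pos_of_pos (by have := NeZero.pos n; positivity)).ne', mul_one,
      Real.mul_rpow two_pos.le Real.pi_pos.le, mul_comm, one_div, Real.inv_rpow two_pos.le,
      ← Real.rpow_neg two_pos.le, neg_div, neg_neg]
  have hpart : ∫⁻ x in S, ENNReal.ofReal (Real.exp (-(1 / 2) * ‖x‖ ^ 2)) =
      ∫⁻ p : (Fin k → ℝ) × EuclideanSpace ℝ (Fin m), B.indicator 1 (‖p.2‖⁻¹ • A *ᵥ p.1) *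
        ENNReal.ofReal (Real.exp (-(1 / 2) * (p.1 ⬝ᵥ p.1 + ‖p.2‖ ^ 2))) := by
    rw [← hb.lintegral_comp, ← lintegral_indicator hS]
    · refine lintegral_congr fun x => ?_
      by_cases hx : x ∈ S
      · have hx' : ‖(blockCoords b x).2‖⁻¹ • A *ᵥ (blockCoords b x).1 ∈ B := hx
        rw [Set.indicator_of_mem hx, Set.indicator_of_mem hx', Pi.one_apply, one_mul,
          norm_sq_eq_blockCoords b]
      · have hx' : ‖(blockCoords b x).2‖⁻¹ • A *ᵥ (blockCoords b x).1 ∉ B := hx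
        rw [Set.indicator_of_notMem hx, Set.indicator_of_notMem hx', zero_mul]
    · refine Measurable.mul ((measurable_one.indicator hB).comp hT) ?_
      have hdot : Measurable fun y : Fin k → ℝ => y ⬝ᵥ y :=
        (Continuous.dotProduct continuous_id continuous_id).measurable
      exact ((((hdot.comp measurable_fst).add (measurable_snd.norm.pow_const 2)).const_mul
        _).exp).ennreal_ofReal
  rw [htot, hpart, lintegral_gaussian_quotient hA hB] at hpolar
  have hc : (0 : ℝ) < (2 * Real.pi) ^ ((n : ℝ) / 2) := by positivity
  have hc' : ENNReal.ofReal ((2 * Real.pi) ^ ((n : ℝ) / 2)) ≠ 0 := by simpa using hc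
  refine (ENNReal.mul_left_inj hc' ENNReal.ofReal_ne_top).1 (hpolar.trans ?_)
  rw [← lintegral_mul_const' _ _ ENNReal.ofReal_ne_top]
  refine setLIntegral_congr_fun hB fun t _ => ?_
  have hQ : 0 ≤ A⁻¹ *ᵥ t ⬝ᵥ A⁻¹ *ᵥ t := Finset.sum_nonneg fun i _ => mul_self_nonneg _
  rw [← ENNReal.ofReal_mul' hc.le]
  congr 1
  rw [← hn, Real.div_rpow (by positivity) two_pos.le, Real.mul_rpow two_pos.le Real.pi_pos.le,
    neg_div, neg_div, Real.rpow_neg two_pos.le]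
  have hpi : Real.pi ^ ((m : ℝ) / 2) = Real.pi ^ (-((k : ℝ) / 2)) * Real.pi ^ ((n : ℝ) / 2) := by
    rw [← Real.rpow_add Real.pi_pos]
    congr 1
    rw [hn]; push_cast; ring
  rw [hpi, div_inv_eq_mul]
  ring

/-- The set where `z = 0`, on which the quotient `A y / |z|` takes a junk value, is null. -/
theorem sphereProb_blockCoords_snd_eq_zero {n k m : ℕ} [NeZero n] [NeZero m]
    (b : OrthonormalBasis (Fin k ⊕ Fin m) ℝ (EuclideanSpace ℝ (Fin n))) :
    SphereAngles.sphereProb n {u | (blockCoords b u).2 = 0} = 0 := by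
  have hm : 0 < m := NeZero.pos m
  have : Nontrivial (EuclideanSpace ℝ (Fin m)) :=
    Module.nontrivial_of_finrank_pos (R := ℝ) (by simpa using hm)
  have hb := measurePreserving_blockCoords b
  have hs : MeasurableSet {p : (Fin k → ℝ) × EuclideanSpace ℝ (Fin m) | p.2 = 0} :=
    measurable_snd (measurableSet_singleton 0)
  set S : Set (EuclideanSpace ℝ (Fin n)) := {x | (blockCoords b x).2 = 0} with hS
  have hvol : volume S = 0 := by
    have h1 : volume S = volume {p : (Fin k → ℝ) × EuclideanSpace ℝ (Fin m) | p.2 = 0} :=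
      hb.measure_preimage hs.nullMeasurableSet
    have h2 : {p : (Fin k → ℝ) × EuclideanSpace ℝ (Fin m) | p.2 = 0} = Set.univ ×ˢ {0} := by
      ext; simp
    rw [h1, h2, Measure.volume_eq_prod, Measure.prod_prod, measure_singleton, mul_zero]
  have hSm : MeasurableSet S := hb.measurable hs
  have hpolar := sphereProb_mul_lintegral_norm n hSm
    (fun r hr x => by simp [hS, blockCoords_smul, hr.ne'])
    (f := fun r => (Set.Iio (1 : ℝ)).indicator 1 r)
    (measurable_one.indicator measurableSet_Iio)
  rw [setLIntegral_measure_zero _ _ hvol, mul_eq_zero] at hpolar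
  refine hpolar.resolve_right ?_
  have : ∫⁻ x : EuclideanSpace ℝ (Fin n), (Set.Iio (1 : ℝ)).indicator (1 : ℝ → ENNReal) ‖x‖ =
      volume (Metric.ball (0 : EuclideanSpace ℝ (Fin n)) 1) := by
    rw [← lintegral_indicator_one measurableSet_ball]
    refine lintegral_congr fun x => ?_
    simp [Set.indicator]
  rw [this]
  exact (Metric.measure_ball_pos _ _ one_pos).ne'

/-! ### Gamma quotients and comparison of the density with the Gaussian density -/

/-- Log-convexity of `Γ` at `x`, `x + 1 / 2`, `x + 1`. -/
theorem Gamma_add_half_le {x : ℝ} (hx : 0 < x) :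
    Real.Gamma (x + 1 / 2) ≤ √x * Real.Gamma x := by
  have hG := Real.Gamma_pos_of_pos hx
  have h := Real.Gamma_mul_add_mul_le_rpow_Gamma_mul_rpow_Gamma (s := x) (t := x + 1)
    (a := 1 / 2) (b := 1 / 2) hx (by linarith) (by norm_num) (by norm_num) (by norm_num)
  rw [Real.Gamma_add_one hx.ne', ← Real.sqrt_eq_rpow, ← Real.sqrt_eq_rpow,
    Real.sqrt_mul hx.le, show 1 / 2 * x + 1 / 2 * (x + 1) = x + 1 / 2 by ring] at h
  calc _ ≤ _ := h
    _ = √x * (√(Real.Gamma x) * √(Real.Gamma x)) := by ring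
    _ = _ := by rw [Real.mul_self_sqrt hG.le]

theorem sqrt_mul_Gamma_le {x : ℝ} (hx : 1 / 2 < x) :
    √(x - 1 / 2) * Real.Gamma x ≤ Real.Gamma (x + 1 / 2) := by
  have hx' : 0 < x - 1 / 2 := by linarith
  have h := Gamma_add_half_le hx'
  rw [sub_add_cancel] at h
  rw [show x + 1 / 2 = (x - 1 / 2) + 1 by ring, Real.Gamma_add_one hx'.ne']
  calc √(x - 1 / 2) * Real.Gamma x
      ≤ √(x - 1 / 2) * (√(x - 1 / 2) * Real.Gamma (x - 1 / 2)) := by gcongr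
    _ = _ := by rw [← mul_assoc, Real.mul_self_sqrt hx'.le]

theorem Gamma_half_ratio_bounds {m : ℕ} (hm : 2 ≤ m) (k : ℕ) :
    √(((m : ℝ) - 1) / 2) ^ k ≤ Real.Gamma (((k + m : ℕ) : ℝ) / 2) / Real.Gamma ((m : ℝ) / 2) ∧
    Real.Gamma (((k + m : ℕ) : ℝ) / 2) / Real.Gamma ((m : ℝ) / 2) ≤
      √(((k + m : ℕ) : ℝ) / 2) ^ k := by
  have hm' : (2 : ℝ) ≤ m := by exact_mod_cast hm
  have hG := Real.Gamma_pos_of_pos (show (0 : ℝ) < (m : ℝ) / 2 by linarith)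
  rw [le_div_iff₀ hG, div_le_iff₀ hG]
  induction k with
  | zero => simp
  | succ k ih =>
    have hkm : (2 : ℝ) ≤ ((k + m : ℕ) : ℝ) := by
      push_cast; have : (0 : ℝ) ≤ k := by positivity
      linarith
    have hx : (1 : ℝ) / 2 < ((k + m : ℕ) : ℝ) / 2 := by linarith
    have e : ((k + 1 + m : ℕ) : ℝ) / 2 = ((k + m : ℕ) : ℝ) / 2 + 1 / 2 := by push_cast; ring
    rw [e]
    have hl := sqrt_mul_Gamma_le hx
    have hu := Gamma_add_half_le (x := ((k + m : ℕ) : ℝ) / 2) (by linarith)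
    have hGk := Real.Gamma_pos_of_pos (show (0 : ℝ) < ((k + m : ℕ) : ℝ) / 2 by linarith)
    constructor
    · calc √(((m : ℝ) - 1) / 2) ^ (k + 1) * Real.Gamma ((m : ℝ) / 2)
          = √(((m : ℝ) - 1) / 2) * (√(((m : ℝ) - 1) / 2) ^ k * Real.Gamma ((m : ℝ) / 2)) := by ring
        _ ≤ √(((k + m : ℕ) : ℝ) / 2 - 1 / 2) * Real.Gamma (((k + m : ℕ) : ℝ) / 2) := by
            refine mul_le_mul (Real.sqrt_le_sqrt ?_) ih.1 (by positivity) (by positivity)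
            push_cast; have : (0 : ℝ) ≤ k := by positivity
            linarith
        _ ≤ _ := hl
    · calc _ ≤ _ := hu
        _ ≤ √(((k + m : ℕ) : ℝ) / 2) *
            (√(((k + m : ℕ) : ℝ) / 2) ^ k * Real.Gamma ((m : ℝ) / 2)) := by gcongr; exact ih.2
        _ = √(((k + m : ℕ) : ℝ) / 2) ^ (k + 1) * Real.Gamma ((m : ℝ) / 2) := by ring
        _ ≤ _ := by gcongr; linarith

/-- The ratio of the normalizing constant of the Student density to that of the Gaussian density. -/
theorem scaled_Gamma_ratio_bounds {n k m : ℕ} (hn : n = k + m) (hm : 2 ≤ m)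
    (hk : 2 * (k + 1) ≤ n) :
    Real.exp (-(2 * k ^ 2 / n)) ≤
      √(2 / n) ^ k * (Real.Gamma ((n : ℝ) / 2) / Real.Gamma ((m : ℝ) / 2)) ∧
    √(2 / n) ^ k * (Real.Gamma ((n : ℝ) / 2) / Real.Gamma ((m : ℝ) / 2)) ≤ 1 := by
  have h := Gamma_half_ratio_bounds hm k
  rw [← hn] at h
  have hm' : (2 : ℝ) ≤ m := by exact_mod_cast hm
  have hn0 : (0 : ℝ) < n := by
    have : 0 < n := by omega
    exact_mod_cast this
  constructor
  · calc Real.exp (-(2 * k ^ 2 / n)) ≤ Real.exp (-((k + 1 : ℝ) / n)) ^ k := by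
          rw [← Real.exp_nat_mul, Real.exp_le_exp, mul_neg, neg_le_neg_iff, ← mul_div_assoc]
          refine div_le_div_of_nonneg_right ?_ hn0.le
          have : (k : ℝ) ≤ k ^ 2 := by
            have : k ≤ k ^ 2 := Nat.le_self_pow two_ne_zero k
            exact_mod_cast this
          nlinarith
      _ ≤ √(1 - (k + 1 : ℝ) / n) ^ k := by
          gcongr
          refine Real.le_sqrt_of_sq_le ?_
          rw [← Real.exp_nat_mul]
          have h2 : (k + 1 : ℝ) / n ≤ 1 / 2 := by
            rw [div_le_iff₀ hn0]
            have : (2 * (k + 1 : ℝ)) ≤ n := by exact_mod_cast hk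
            linarith
          have := exp_neg_two_mul_le_one_sub (x := (k + 1 : ℝ) / n) (by positivity) h2
          simpa using this
      _ = √(2 / n) ^ k * √(((m : ℝ) - 1) / 2) ^ k := by
          rw [← mul_pow, ← Real.sqrt_mul (by positivity)]
          congr 2
          have : (n : ℝ) = k + m := by exact_mod_cast hn
          field_simp
          linarith
      _ ≤ _ := by gcongr; exact h.1
  · calc _ ≤ √(2 / n) ^ k * √((n : ℝ) / 2) ^ k := by gcongr; exact h.2
      _ = 1 := by
          rw [← mul_pow, ← Real.sqrt_mul (by positivity)]
          field_simp
          simp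

theorem one_add_div_rpow_bounds {n : ℕ} (hn : 0 < n) {Q : ℝ} (hQ : 0 ≤ Q) :
    Real.exp (-(Q / 2)) ≤ (1 + Q / n) ^ (-(n : ℝ) / 2) ∧
    (1 + Q / n) ^ (-(n : ℝ) / 2) ≤ Real.exp (-(Q / 2) + Q ^ 2 / (4 * n)) := by
  have hn0 : (0 : ℝ) < n := by exact_mod_cast hn
  have hx : 0 ≤ Q / n := by positivity
  rw [Real.rpow_def_of_pos (by positivity), Real.exp_le_exp, Real.exp_le_exp]
  have hu : Real.log (1 + Q / n) ≤ Q / n := by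
    have := Real.log_le_sub_one_of_pos (show 0 < 1 + Q / n by positivity)
    linarith
  have hl : Q / n - (Q / n) ^ 2 / 2 ≤ Real.log (1 + Q / n) := by
    refine le_trans ?_ (Real.le_log_one_add_of_nonneg hx)
    rw [le_div_iff₀ (by positivity)]
    nlinarith [pow_nonneg hx 3]
  have e1 : Q / 2 = Q / n * (n / 2) := by field_simp
  have e2 : Q ^ 2 / (4 * n) = (Q / n) ^ 2 / 2 * (n / 2) := by field_simp; ring
  have hn2 : (0 : ℝ) < n / 2 := by positivity
  constructor
  · rw [e1]; nlinarith
  · rw [e1, e2]; nlinarith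

theorem setLIntegral_prod_gaussianPDFReal {k : ℕ} (a b : Fin k → ℝ) :
    ∫⁻ t in Set.univ.pi fun i => Set.Ioc (a i) (b i),
      ENNReal.ofReal (∏ i, gaussianPDFReal 0 1 (t i)) =
    ENNReal.ofReal (∏ i, (gaussianReal 0 1).real (Set.Ioc (a i) (b i))) := by
  rw [volume_pi, Measure.restrict_pi_pi, ← ofReal_integral_eq_lintegral_ofReal]
  · rw [integral_fintype_prod_eq_prod]
    congr 1
    refine Finset.prod_congr rfl fun i _ => ?_
    rw [measureReal_def, gaussianReal_apply_eq_integral 0 one_ne_zero, ENNReal.toReal_ofReal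
      (integral_nonneg fun x => gaussianPDFReal_nonneg _ _ _)]
  · exact Integrable.fintype_prod fun i => (integrable_gaussianPDFReal 0 1).restrict
  · exact .of_forall fun t => Finset.prod_nonneg fun i _ => gaussianPDFReal_nonneg _ _ _

open Matrix in
theorem prod_gaussianPDFReal {k : ℕ} (t : Fin k → ℝ) :
    ∏ i, gaussianPDFReal 0 1 (t i) =
      (2 * Real.pi) ^ (-(k : ℝ) / 2) * Real.exp (-(t ⬝ᵥ t / 2)) := by
  simp only [gaussianPDFReal, Finset.prod_mul_distrib, ← Real.exp_sum, Finset.prod_const,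
    Finset.card_univ, Fintype.card_fin]
  congr 1
  · rw [NNReal.coe_one, mul_one, Real.sqrt_eq_rpow, ← Real.rpow_neg (by positivity),
      ← Real.rpow_natCast, ← Real.rpow_mul (by positivity)]
    congr 1; ring
  · congr 1
    rw [dotProduct, Finset.sum_div, ← Finset.sum_neg_distrib]
    refine Finset.sum_congr rfl fun i _ => ?_
    simp; ring

open Matrix in
theorem abs_det_bounds {k : ℕ} {A : Matrix (Fin k) (Fin k) ℝ} {β : ℝ} (hβ : 0 ≤ β)
    (hkβ : k * β ≤ 1 / 2) (hdiag : ∀ i, (A * Aᵀ) i i = 1)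
    (hoff : ∀ i j, i ≠ j → |(A * Aᵀ) i j| ≤ β) :
    A.det ≠ 0 ∧ Real.exp (-(k ^ 2 * β)) ≤ |A.det|⁻¹ ∧ |A.det|⁻¹ ≤ Real.exp (k ^ 2 * β) := by
  have h := det_bounds_of_near_one hβ hkβ (isHermitian_mul_conjTranspose_self A) hdiag hoff
  rw [det_mul, conjTranspose_eq_transpose_of_trivial, det_transpose, ← sq, ← sq_abs] at h
  have h0 : A.det ≠ 0 := by
    intro h0
    have := (Real.exp_pos _).trans_le h.1
    simp [h0] at this
  have hpos : 0 < |A.det| := abs_pos.2 h0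
  refine ⟨h0, ?_, ?_⟩
  · rw [Real.exp_neg]
    refine inv_anti₀ hpos ((sq_le_sq₀ hpos.le (Real.exp_pos _).le).1 ?_)
    rw [← Real.exp_nat_mul]
    simpa using h.2
  · rw [← inv_inv (Real.exp (k ^ 2 * β)), ← Real.exp_neg]
    refine inv_anti₀ (Real.exp_pos _) ((sq_le_sq₀ (Real.exp_pos _).le hpos.le).1 ?_)
    rw [← Real.exp_nat_mul, mul_neg]
    simpa using h.1

open Matrix in
/-- On the cube `[-R, R]^k` the density of `√n A y / |z|` agrees with the standard Gaussian density
up to a factor `exp (± C k² / √n)`. -/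
theorem quotient_density_bounds {n k m : ℕ} (hn : n = k + m) (hm : 2 ≤ m)
    (hk : 2 * (k + 1) ≤ n) {A : Matrix (Fin k) (Fin k) ℝ} {K R : ℝ} (hK : 0 ≤ K) (hR : 0 ≤ R)
    (hkK : k * (K / √n) ≤ 1 / 2) (hdiag : ∀ i, (A * Aᵀ) i i = 1)
    (hoff : ∀ i j, i ≠ j → |(A * Aᵀ) i j| ≤ K / √n) {t : Fin k → ℝ} (ht : ∀ i, |t i| ≤ R) :
    let f := |(√(n : ℝ) • A).det|⁻¹ * (Real.pi ^ (-(k : ℝ) / 2) *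
      (Real.Gamma ((n : ℝ) / 2) / Real.Gamma ((m : ℝ) / 2)) *
      (1 + (√(n : ℝ) • A)⁻¹ *ᵥ t ⬝ᵥ (√(n : ℝ) • A)⁻¹ *ᵥ t) ^ (-(n : ℝ) / 2))
    let C := K + K * R ^ 2 + R ^ 4 + 2
    Real.exp (-(C * (k ^ 2 / √n))) * ∏ i, gaussianPDFReal 0 1 (t i) ≤ f ∧
      f ≤ Real.exp (C * (k ^ 2 / √n)) * ∏ i, gaussianPDFReal 0 1 (t i) := by
  intro f C
  have hn1 : 0 < n := by omega
  have hn0 : (0 : ℝ) < n := by exact_mod_cast hn1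
  have hs : 0 < √(n : ℝ) := Real.sqrt_pos.2 hn0
  set β := K / √(n : ℝ) with hβdef
  have hβ : 0 ≤ β := by positivity
  obtain ⟨hdet, hd1, hd2⟩ := abs_det_bounds hβ hkK hdiag hoff
  obtain ⟨hg1, hg2⟩ := scaled_Gamma_ratio_bounds hn hm hk
  set y := A⁻¹ *ᵥ t with hy
  have hAy : A *ᵥ y = t := by
    rw [hy, mulVec_mulVec, mul_nonsing_inv _ (isUnit_iff_ne_zero.2 hdet), one_mulVec]
  have hyt := abs_le.1
    (abs_dotProduct_self_sub_le hβ hR hkK (isUnit_iff_ne_zero.2 hdet) hdiag hoff hAy ht)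
  set Q := y ⬝ᵥ y with hQdef
  have hQ : 0 ≤ Q := Finset.sum_nonneg fun i _ => mul_self_nonneg _
  obtain ⟨hq1, hq2⟩ := one_add_div_rpow_bounds hn1 hQ
  have htt : t ⬝ᵥ t ≤ k * R ^ 2 := by
    calc t ⬝ᵥ t ≤ ∑ _i : Fin k, R ^ 2 := Finset.sum_le_sum fun i _ => by
          rw [← sq, ← sq_abs]; exact pow_le_pow_left₀ (abs_nonneg _) (ht i) 2
      _ = _ := by simp
  have hf : f = |A.det|⁻¹ * (√(2 / n) ^ k *
      (Real.Gamma ((n : ℝ) / 2) / Real.Gamma ((m : ℝ) / 2))) * (1 + Q / n) ^ (-(n : ℝ) / 2) *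
      (2 * Real.pi) ^ (-(k : ℝ) / 2) := by
    have hinv : (√(n : ℝ) • A)⁻¹ = (√(n : ℝ))⁻¹ • A⁻¹ := by
      apply inv_eq_right_inv
      rw [smul_mul_smul_comm, mul_inv_cancel₀ hs.ne', one_smul,
        mul_nonsing_inv _ (isUnit_iff_ne_zero.2 hdet)]
    have e1 : (√(n : ℝ) • A)⁻¹ *ᵥ t ⬝ᵥ (√(n : ℝ) • A)⁻¹ *ᵥ t = Q / n := by
      rw [hinv, smul_mulVec, smul_dotProduct, dotProduct_smul, smul_smul, ← mul_inv,
        Real.mul_self_sqrt hn0.le, smul_eq_mul, inv_mul_eq_div]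
    have e2 : |(√(n : ℝ) • A).det|⁻¹ = (√(n : ℝ) ^ k)⁻¹ * |A.det|⁻¹ := by
      rw [det_smul, Fintype.card_fin, abs_mul, abs_of_pos (by positivity : 0 < √(n : ℝ) ^ k),
        mul_inv]
    have e3 : (√(n : ℝ) ^ k)⁻¹ * Real.pi ^ (-(k : ℝ) / 2) =
        √(2 / n) ^ k * (2 * Real.pi) ^ (-(k : ℝ) / 2) := by
      rw [Real.mul_rpow two_pos.le Real.pi_pos.le, Real.sqrt_div two_pos.le, div_pow]
      have : √(2 : ℝ) ^ k * 2 ^ (-(k : ℝ) / 2) = 1 := by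
        rw [Real.sqrt_eq_rpow, ← Real.rpow_natCast, ← Real.rpow_mul two_pos.le,
          ← Real.rpow_add two_pos]
        convert Real.rpow_zero 2 using 2
        ring
      calc _ = (√(n : ℝ) ^ k)⁻¹ * Real.pi ^ (-(k : ℝ) / 2) * 1 := by ring
        _ = _ := by rw [← this]; ring
    simp only [f]
    rw [e1, e2]
    calc _ = (√(n : ℝ) ^ k)⁻¹ * Real.pi ^ (-(k : ℝ) / 2) * (|A.det|⁻¹ *
          (Real.Gamma ((n : ℝ) / 2) / Real.Gamma ((m : ℝ) / 2)) *
          (1 + Q / n) ^ (-(n : ℝ) / 2)) := by ring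
      _ = _ := by rw [e3]; ring
  have hnn : 1 / (n : ℝ) ≤ 1 / √n := by
    refine one_div_le_one_div_of_le hs ((Real.sqrt_le_left hn0.le).2 ?_)
    have : (1 : ℝ) ≤ n := by exact_mod_cast hn1
    nlinarith
  have hk2 : (0 : ℝ) ≤ k ^ 2 := by positivity
  have hkn : (k : ℝ) ^ 2 / n ≤ k ^ 2 / √n := by
    rw [div_eq_mul_one_div, div_eq_mul_one_div ((k : ℝ) ^ 2)]
    gcongr
  have hkn0 : (0 : ℝ) ≤ k ^ 2 / √n := by positivity
  have hkβ : k ^ 2 * β = K * (k ^ 2 / √n) := by rw [hβdef]; ring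
  have hQu : Q ≤ 2 * k * R ^ 2 := by
    have : (k : ℝ) * (k * β) * R ^ 2 ≤ k * (1 / 2) * R ^ 2 := by gcongr
    nlinarith [hyt.2]
  have hQn : Q ^ 2 / (4 * n) ≤ R ^ 4 * (k ^ 2 / √n) := by
    calc Q ^ 2 / (4 * n) ≤ (2 * k * R ^ 2) ^ 2 / (4 * n) := by gcongr
      _ = R ^ 4 * (k ^ 2 / n) := by field_simp; ring
      _ ≤ _ := by gcongr
  have hKR : 2 * k ^ 2 * β * R ^ 2 = 2 * (K * R ^ 2 * (k ^ 2 / √n)) := by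
    rw [mul_assoc 2, hkβ]; ring
  rw [hKR] at hyt
  have hK1 : 0 ≤ K * (k ^ 2 / √n) := by positivity
  have hR4 : 0 ≤ R ^ 4 * (k ^ 2 / √n) := by positivity
  have h2k : (2 * k ^ 2 / n : ℝ) ≤ 2 * (k ^ 2 / √n) := by
    rw [mul_div_assoc]; linarith
  have hp : (0 : ℝ) ≤ (2 * Real.pi) ^ (-(k : ℝ) / 2) := by positivity
  rw [hkβ] at hd1 hd2
  rw [hf, prod_gaussianPDFReal]
  constructor
  · calc _ = Real.exp (-(C * (k ^ 2 / √n)) - t ⬝ᵥ t / 2) * (2 * Real.pi) ^ (-(k : ℝ) / 2) := by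
          rw [sub_eq_add_neg, Real.exp_add]; ring
      _ ≤ Real.exp (-(K * (k ^ 2 / √n))) * Real.exp (-(2 * k ^ 2 / n)) * Real.exp (-(Q / 2)) *
            (2 * Real.pi) ^ (-(k : ℝ) / 2) := by
          rw [← Real.exp_add, ← Real.exp_add]
          refine mul_le_mul_of_nonneg_right (Real.exp_le_exp.2 ?_) hp
          simp only [C, add_mul]
          linarith [hyt.2]
      _ ≤ _ := by gcongr
  · calc _ ≤ Real.exp (K * (k ^ 2 / √n)) * 1 * Real.exp (-(Q / 2) + Q ^ 2 / (4 * n)) *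
            (2 * Real.pi) ^ (-(k : ℝ) / 2) := by
          have : 0 ≤ √(2 / (n : ℝ)) ^ k *
            (Real.Gamma ((n : ℝ) / 2) / Real.Gamma ((m : ℝ) / 2)) := (Real.exp_pos _).le.trans hg1
          gcongr
      _ ≤ Real.exp (C * (k ^ 2 / √n) - t ⬝ᵥ t / 2) * (2 * Real.pi) ^ (-(k : ℝ) / 2) := by
          rw [mul_one, ← Real.exp_add]
          refine mul_le_mul_of_nonneg_right (Real.exp_le_exp.2 ?_) hp
          simp only [C, add_mul]
          linarith [hyt.1]
      _ = _ := by rw [sub_eq_add_neg, Real.exp_add]; ring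

open Matrix in
theorem sphereProb_quotient_box_bounds {n k m : ℕ} [NeZero n] (hn : n = k + m) (hm : 2 ≤ m)
    (hk : 2 * (k + 1) ≤ n)
    (b : OrthonormalBasis (Fin k ⊕ Fin m) ℝ (EuclideanSpace ℝ (Fin n)))
    {A : Matrix (Fin k) (Fin k) ℝ} {K R : ℝ} (hK : 0 ≤ K) (hR : 0 ≤ R)
    (hkK : k * (K / √n) ≤ 1 / 2) (hdiag : ∀ i, (A * Aᵀ) i i = 1)
    (hoff : ∀ i j, i ≠ j → |(A * Aᵀ) i j| ≤ K / √n) {l r : Fin k → ℝ}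
    (hl : ∀ i, -R ≤ l i) (hr : ∀ i, r i ≤ R) :
    let p := (SphereAngles.sphereProb n).real
      {u | ∀ i, (√(n : ℝ) • ‖(blockCoords b u).2‖⁻¹ • A *ᵥ (blockCoords b u).1) i ∈
        Set.Ioc (l i) (r i)}
    let g := ∏ i, (gaussianReal 0 1).real (Set.Ioc (l i) (r i))
    let C := K + K * R ^ 2 + R ^ 4 + 2
    Real.exp (-(C * (k ^ 2 / √n))) * g ≤ p ∧ p ≤ Real.exp (C * (k ^ 2 / √n)) * g := by
  intro p g C
  have hn1 : 0 < n := by omega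
  have hs : 0 < √(n : ℝ) := Real.sqrt_pos.2 (by exact_mod_cast hn1)
  have : NeZero m := ⟨by omega⟩
  obtain ⟨hdet, -, -⟩ := abs_det_bounds (by positivity) hkK hdiag hoff
  have hdet' : (√(n : ℝ) • A).det ≠ 0 := by
    rw [det_smul]; exact mul_ne_zero (by positivity) hdet
  set B : Set (Fin k → ℝ) := Set.univ.pi fun i => Set.Ioc (l i) (r i) with hBdef
  have hB : MeasurableSet B := .univ_pi fun i => measurableSet_Ioc
  have hset : {u : SphereAngles.Sph n | ∀ i,
      (√(n : ℝ) • ‖(blockCoords b u).2‖⁻¹ • A *ᵥ (blockCoords b u).1) i ∈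
        Set.Ioc (l i) (r i)} =
      {u : SphereAngles.Sph n | ‖(blockCoords b u).2‖⁻¹ • (√(n : ℝ) • A) *ᵥ (blockCoords b u).1 ∈ B} := by
    ext u
    simp only [hBdef, Set.mem_ofPred_eq, Set.mem_univ_pi, smul_mulVec, smul_comm (√(n : ℝ))]
  have hP : SphereAngles.sphereProb n {u : SphereAngles.Sph n | ∀ i,
      (√(n : ℝ) • ‖(blockCoords b u).2‖⁻¹ • A *ᵥ (blockCoords b u).1) i ∈
        Set.Ioc (l i) (r i)} = _ := hset ▸ sphereProb_quotient hn b hdet' hB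
  have hg0 : 0 ≤ g := Finset.prod_nonneg fun _ _ => measureReal_nonneg
  have hg : ∀ c : ℝ, 0 ≤ c → ENNReal.ofReal (c * g) =
      ∫⁻ t in B, ENNReal.ofReal (c * ∏ i, gaussianPDFReal 0 1 (t i)) := by
    intro c hc
    simp only [ENNReal.ofReal_mul hc]
    rw [lintegral_const_mul' _ _ ENNReal.ofReal_ne_top, setLIntegral_prod_gaussianPDFReal]
  have hdens := fun (t : Fin k → ℝ) (ht : t ∈ B) =>
    quotient_density_bounds hn hm hk hK hR hkK hdiag hoff (t := t) fun i => by
      have := ht i trivial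
      exact abs_le.2 ⟨(hl i).trans this.1.le, this.2.trans (hr i)⟩
  constructor
  · refine (ENNReal.ofReal_le_iff_le_toReal (measure_ne_top _ _)).1 ?_
    rw [hP, hg _ (Real.exp_pos _).le]
    exact setLIntegral_mono' hB fun t ht => ENNReal.ofReal_le_ofReal (hdens t ht).1
  · refine ENNReal.toReal_le_of_le_ofReal (by positivity) ?_
    rw [hP, hg _ (Real.exp_pos _).le]
    exact setLIntegral_mono' hB fun t ht => ENNReal.ofReal_le_ofReal (hdens t ht).2

/-! ### Orthonormal bases adapted to a family of vectors -/

/-- A basis of the span of the `w i` is extended to an orthonormal basis of the whole space. The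
`w i` need not be independent, so the first block may contain vectors outside their span. -/
theorem exists_orthonormalBasis_inr_orthogonal {n k m : ℕ} (hn : n = k + m)
    (w : Fin k → EuclideanSpace ℝ (Fin n)) :
    ∃ b : OrthonormalBasis (Fin k ⊕ Fin m) ℝ (EuclideanSpace ℝ (Fin n)),
      ∀ i j, inner ℝ (w i) (b (Sum.inr j)) = 0 := by
  set W := Submodule.span ℝ (Set.range w)
  have hd : Module.finrank ℝ W ≤ k := 
    (finrank_range_le_card (R := ℝ) w).trans_eq (Fintype.card_fin k)
  set e := stdOrthonormalBasis ℝ W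
  set v : Fin k ⊕ Fin m → EuclideanSpace ℝ (Fin n) := fun i =>
    Sum.elim (fun a : Fin k => if h : (a : ℕ) < Module.finrank ℝ W then (e ⟨a, h⟩ : _) else 0)
      (fun _ => 0) i with hv
  set s : Set (Fin k ⊕ Fin m) := Set.range fun a => Sum.inl (Fin.castLE hd a)
  have hvs : ∀ a, v (Sum.inl (Fin.castLE hd a)) = e a := by intro a; simp [hv]
  have hon : Orthonormal ℝ (s.domRestrict v) := by
    rw [orthonormal_iff_ite]
    rintro ⟨_, a, rfl⟩ ⟨_, a', rfl⟩
    have := orthonormal_iff_ite.1 e.orthonormal a a'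
    simp only [Set.domRestrict_apply, hvs]
    rw [← Submodule.coe_inner, this]
    refine if_congr ⟨?_, fun h => ?_⟩ rfl rfl
    · rintro rfl; rfl
    · exact Fin.castLE_injective hd (Sum.inl.inj (congrArg Subtype.val h))
  obtain ⟨b, hb⟩ := hon.exists_orthonormalBasis_extension_of_card_eq (by simp [hn])
  refine ⟨b, fun i j => ?_⟩
  have hwi : w i ∈ W := Submodule.subset_span ⟨i, rfl⟩
  have hexp := e.sum_repr ⟨w i, hwi⟩
  have hexp' : w i = ∑ a, e.repr ⟨w i, hwi⟩ a • (e a : EuclideanSpace ℝ (Fin n)) := by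
    have := congrArg Subtype.val hexp
    simpa using this.symm
  rw [hexp', sum_inner]
  refine Finset.sum_eq_zero fun a _ => ?_
  rw [inner_smul_left, ← hvs, ← hb _ ⟨a, rfl⟩, b.orthonormal.2 (by simp), mul_zero]

open Matrix in
theorem exists_orthonormalBasis_coords {n k m : ℕ} (hn : n = k + m)
    (w : Fin k → EuclideanSpace ℝ (Fin n)) :
    ∃ (b : OrthonormalBasis (Fin k ⊕ Fin m) ℝ (EuclideanSpace ℝ (Fin n)))
      (A : Matrix (Fin k) (Fin k) ℝ), (∀ x i, (A *ᵥ (blockCoords b x).1) i = inner ℝ (w i) x) ∧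
        ∀ i j, (A * Aᵀ) i j = inner ℝ (w i) (w j) := by
  obtain ⟨b, hb⟩ := exists_orthonormalBasis_inr_orthogonal hn w
  have h1 : ∀ x i, (Matrix.of (fun i a => inner ℝ (w i) (b (Sum.inl a))) *ᵥ
      (blockCoords b x).1) i = inner ℝ (w i) x := by
    intro x i
    rw [← b.sum_inner_mul_inner (w i) x, Fintype.sum_sum_type]
    simp [mulVec, dotProduct, blockCoords, hb, b.repr_apply_apply]
  refine ⟨b, Matrix.of fun i a => inner ℝ (w i) (b (Sum.inl a)), h1, fun i j => ?_⟩
  rw [← h1 (w j) i]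
  simp [mul_apply, mulVec, dotProduct, blockCoords, b.repr_apply_apply, real_inner_comm]

/-! ### Arcsines and tangent coordinates -/

theorem abs_arcsin_sub_le {s : ℝ} (hs : |s| ≤ 1) : |Real.arcsin s - s| ≤ |s| ^ 3 := by
  wlog h : 0 ≤ s generalizing s
  · have := this (s := -s) (by rwa [abs_neg]) (by linarith)
    rw [Real.arcsin_neg, abs_neg] at this
    rwa [← abs_neg, neg_sub', sub_neg_eq_add, ← sub_neg_eq_add]
  rw [abs_of_nonneg h] at hs ⊢
  have h0 : 0 ≤ Real.arcsin s := Real.arcsin_nonneg.2 h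
  have hsin : Real.sin (Real.arcsin s) = s := Real.sin_arcsin (by linarith) hs
  have h1 : s ≤ Real.arcsin s := by
    have := Real.sin_le h0
    rwa [hsin] at this
  rw [abs_of_nonneg (by linarith)]
  rcases h0.eq_or_lt with h0' | h0'
  · rw [← h0'] at h1 ⊢
    have : 0 ≤ s ^ 3 := by positivity
    linarith
  have h2 := Real.sin_gt_sub_cube h0'
  have h3 := Real.mul_le_sin h0 (Real.arcsin_le_pi_div_two s)
  rw [hsin] at h2 h3
  have h4 : Real.arcsin s ≤ 8 / 5 * s := by
    rw [div_mul_eq_mul_div, div_le_iff₀ Real.pi_pos] at h3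
    have := Real.pi_lt_d2
    nlinarith
  have h5 : Real.arcsin s ^ 3 ≤ (8 / 5 * s) ^ 3 := pow_le_pow_left₀ h0 h4 3
  have : 0 ≤ s ^ 3 := by positivity
  nlinarith

theorem abs_le_of_abs_arcsin_le {s β : ℝ} (hs : |s| ≤ 1) (h : |Real.arcsin s| ≤ β) :
    |s| ≤ β := by
  obtain ⟨h1, h2⟩ := abs_le.1 hs
  calc |s| = |Real.sin (Real.arcsin s)| := by rw [Real.sin_arcsin h1 h2]
    _ ≤ |Real.arcsin s| := Real.abs_sin_le_abs
    _ ≤ β := h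

theorem abs_mul_div_sub_mul_arcsin_le {a s β ρ d : ℝ} (ha : 0 ≤ a) (hs : |s| ≤ 1) (hsβ : |s| ≤ β)
    (hd : |a * ρ⁻¹ * s - a * s| ≤ a * β * d) :
    |a * ρ⁻¹ * s - a * Real.arcsin s| ≤ a * β * (d + β ^ 2) := by
  have h1 := abs_arcsin_sub_le hs
  have h2 : |s| ^ 3 ≤ β ^ 3 := pow_le_pow_left₀ (abs_nonneg _) hsβ 3
  calc |a * ρ⁻¹ * s - a * Real.arcsin s|
      = |(a * ρ⁻¹ * s - a * s) - a * (Real.arcsin s - s)| := by congr 1; ring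
    _ ≤ |a * ρ⁻¹ * s - a * s| + |a * (Real.arcsin s - s)| := abs_sub _ _
    _ ≤ a * β * d + a * β ^ 3 := by
        rw [abs_mul a, abs_of_nonneg ha]
        gcongr
        exact h1.trans h2
    _ = _ := by ring

open Matrix in
/-- For a unit vector `(y, z)` with `|z| = ρ`, the tangent coordinates `A y / ρ` and the arcsines of
`A y` differ by a quantity of third order as soon as either of them is bounded by `β`; `a` is a
scaling factor. -/
theorem abs_quotient_sub_arcsin_le {k : ℕ} {A : Matrix (Fin k) (Fin k) ℝ} {β a ρ : ℝ}
    (hβ : 0 ≤ β) (ha : 0 ≤ a)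
    (hkβ : k * β ≤ 1 / 2) (hA : IsUnit A.det) (hdiag : ∀ i, (A * Aᵀ) i i = 1)
    (hoff : ∀ i j, i ≠ j → |(A * Aᵀ) i j| ≤ β) {y : Fin k → ℝ} (hρ : 0 < ρ)
    (hy : y ⬝ᵥ y + ρ ^ 2 = 1) (hs : ∀ i, |(A *ᵥ y) i| ≤ 1)
    (h : (∀ i, |Real.arcsin ((A *ᵥ y) i)| ≤ β) ∨ ∀ i, |ρ⁻¹ * (A *ᵥ y) i| ≤ β) (i : Fin k) :
    |a * ρ⁻¹ * (A *ᵥ y) i - a * Real.arcsin ((A *ᵥ y) i)| ≤ a * β * (3 * k * β ^ 2) := by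
  have hyy : 0 ≤ y ⬝ᵥ y := Finset.sum_nonneg fun i _ => mul_self_nonneg _
  have hρ1 : ρ ≤ 1 := by nlinarith
  have hk : (1 : ℝ) ≤ k := by
    have : 0 < k := i.pos
    exact_mod_cast this
  have hβ2 : β ≤ 1 / 2 := by nlinarith
  have hbound : ∀ y' : Fin k → ℝ, (∀ i, |(A *ᵥ y') i| ≤ β) → y' ⬝ᵥ y' ≤ 2 * k * β ^ 2 := by
    intro y' hy'
    have h1 := abs_le.1 (abs_dotProduct_self_sub_le hβ hβ hkβ hA hdiag hoff rfl hy')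
    have h2 : (A *ᵥ y') ⬝ᵥ (A *ᵥ y') ≤ k * β ^ 2 := by
      calc (A *ᵥ y') ⬝ᵥ (A *ᵥ y') ≤ ∑ _i : Fin k, β ^ 2 := Finset.sum_le_sum fun i _ => by
            rw [← sq, ← sq_abs]; exact pow_le_pow_left₀ (abs_nonneg _) (hy' i) 2
        _ = _ := by simp
    have h3 : (k : ℝ) * (k * β) * β ^ 2 ≤ k * (1 / 2) * β ^ 2 := by gcongr
    nlinarith [h1.2]
  have hinv1 : 1 ≤ ρ⁻¹ := (one_le_inv₀ hρ).2 hρ1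
  have hfin : |(A *ᵥ y) i| ≤ β ∧
      |a * ρ⁻¹ * (A *ᵥ y) i - a * (A *ᵥ y) i| ≤ a * β * (2 * k * β ^ 2) := by
    rcases h with h | h
    · have hsβ := fun i => abs_le_of_abs_arcsin_le (hs i) (h i)
      have hyb := hbound y hsβ
      refine ⟨hsβ i, ?_⟩
      set d := 2 * k * β ^ 2 with hd
      have hd2 : d ≤ 1 / 2 := by nlinarith
      have hinv : ρ⁻¹ ≤ 1 + d := by
        rw [inv_le_iff_one_le_mul₀ hρ]
        have hρ2 : 1 - d ≤ ρ ^ 2 := by linarith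
        by_contra! hlt
        have h0 : 0 ≤ (1 + d) * ρ := by positivity
        have h1 : ((1 + d) * ρ) ^ 2 < 1 := by nlinarith
        have hd0 : 0 ≤ d := by positivity
        nlinarith [mul_nonneg hd0 (sq_nonneg d), mul_le_mul_of_nonneg_left hρ2 (sq_nonneg (1 + d))]
      rw [show a * ρ⁻¹ * (A *ᵥ y) i - a * (A *ᵥ y) i = a * (A *ᵥ y) i * (ρ⁻¹ - 1) by ring,
        abs_mul, abs_mul, abs_of_nonneg ha, abs_of_nonneg (by linarith : 0 ≤ ρ⁻¹ - 1)]
      gcongr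
      · exact hsβ i
      · linarith
    · have hyb := hbound (ρ⁻¹ • y)
        (by simpa only [mulVec_smul, Pi.smul_apply, smul_eq_mul] using h)
      rw [smul_dotProduct, dotProduct_smul, smul_eq_mul, smul_eq_mul] at hyb
      have hs' : |(A *ᵥ y) i| = ρ * |ρ⁻¹ * (A *ᵥ y) i| := by
        rw [abs_mul, abs_of_pos (inv_pos.2 hρ), mul_inv_cancel_left₀ hρ.ne']
      refine ⟨?_, ?_⟩
      · rw [hs']
        calc ρ * |ρ⁻¹ * (A *ᵥ y) i| ≤ 1 * β := by gcongr; exact h i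
          _ = β := one_mul β
      rw [show a * ρ⁻¹ * (A *ᵥ y) i - a * (A *ᵥ y) i = a * (ρ⁻¹ * (A *ᵥ y) i) * (1 - ρ) by
        field_simp, abs_mul, abs_mul, abs_of_nonneg ha, abs_of_nonneg (by linarith : 0 ≤ 1 - ρ)]
      gcongr
      · exact h i
      · have h1 : y ⬝ᵥ y ≤ ρ⁻¹ * (ρ⁻¹ * y ⬝ᵥ y) := by
          rw [← mul_assoc]
          exact le_mul_of_one_le_left hyy (one_le_mul_of_one_le_of_one_le hinv1 hinv1)
        nlinarith
  refine (abs_mul_div_sub_mul_arcsin_le ha (hs i) hfin.1 hfin.2).trans ?_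
  have : 0 ≤ a * β := by positivity
  gcongr
  nlinarith [sq_nonneg β]

/-! ### Gaussian probabilities of intervals -/

theorem gaussianReal_Ioc_le {a b : ℝ} (hab : a ≤ b) :
    (gaussianReal 0 1).real (Set.Ioc a b) ≤ b - a := by
  rw [measureReal_def, gaussianReal_apply_eq_integral 0 one_ne_zero, ENNReal.toReal_ofReal
    (integral_nonneg fun x => gaussianPDFReal_nonneg _ _ _)]
  calc ∫ x in Set.Ioc a b, gaussianPDFReal 0 1 x ≤ ∫ _x in Set.Ioc a b, (1 : ℝ) := by
        refine setIntegral_mono (integrable_gaussianPDFReal 0 1).integrableOn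
          (integrableOn_const (by simp)) fun x => ?_
        simp only [gaussianPDFReal, NNReal.coe_one, mul_one, sub_zero]
        have h1 : (√(2 * Real.pi))⁻¹ ≤ 1 := by
          refine inv_le_one_of_one_le₀ (Real.one_le_sqrt.2 ?_)
          linarith [Real.pi_gt_three]
        have h2 : Real.exp (-x ^ 2 / 2) ≤ 1 := Real.exp_le_one_iff.2 (by nlinarith [sq_nonneg x])
        calc _ ≤ (1 : ℝ) * 1 := by gcongr
          _ = 1 := one_mul 1
    _ = b - a := by simp [hab]

theorem le_gaussianReal_Ioc {K a b : ℝ} (ha : -K ≤ a) (hb : b ≤ K) (hab : a ≤ b) :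
    (b - a) * gaussianPDFReal 0 1 K ≤ (gaussianReal 0 1).real (Set.Ioc a b) := by
  rw [measureReal_def, gaussianReal_apply_eq_integral 0 one_ne_zero, ENNReal.toReal_ofReal
    (integral_nonneg fun x => gaussianPDFReal_nonneg _ _ _)]
  calc (b - a) * gaussianPDFReal 0 1 K = ∫ _x in Set.Ioc a b, gaussianPDFReal 0 1 K := by
        simp [hab]
    _ ≤ _ := by
        refine setIntegral_mono_on (integrableOn_const (by simp))
          (integrable_gaussianPDFReal 0 1).integrableOn measurableSet_Ioc fun x hx => ?_
        simp only [gaussianPDFReal, NNReal.coe_one, mul_one, sub_zero]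
        have : x ^ 2 ≤ K ^ 2 := sq_le_sq' (by linarith [hx.1]) (by linarith [hx.2])
        gcongr

/-- Moving both end points of an interval of length at least `ε` by `δ` changes its Gaussian
probability by a factor `exp (O(δ))`. -/
theorem gaussianReal_Ioc_widen {K ε : ℝ} (hε : 0 < ε) {c c' δ : ℝ} (hδ : 0 ≤ δ)
    (hc : -K ≤ c) (hc' : c' ≤ K) (h : ε ≤ c' - c)
    (hδ' : 2 * δ / (ε * gaussianPDFReal 0 1 K) ≤ 1 / 2) :
    (gaussianReal 0 1).real (Set.Ioc (c - δ) (c' + δ)) ≤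
      Real.exp (4 * δ / (ε * gaussianPDFReal 0 1 K)) * (gaussianReal 0 1).real (Set.Ioc c c') ∧
    Real.exp (-(4 * δ / (ε * gaussianPDFReal 0 1 K))) * (gaussianReal 0 1).real (Set.Ioc c c') ≤
      (gaussianReal 0 1).real (Set.Ioc (c + δ) (c' - δ)) := by
  set g₀ := ε * gaussianPDFReal 0 1 K with hg₀
  have hg0 : 0 < g₀ := mul_pos hε (gaussianPDFReal_pos _ _ _ one_ne_zero)
  set γ := gaussianReal 0 1
  have hg : g₀ ≤ γ.real (Set.Ioc c c') :=
    (mul_le_mul_of_nonneg_right h (gaussianPDFReal_nonneg _ _ _)).trans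
      (le_gaussianReal_Ioc hc hc' (by linarith))
  set g := γ.real (Set.Ioc c c')
  have hδg : 2 * δ ≤ 2 * δ / g₀ * g := by
    rw [div_mul_eq_mul_div, le_div_iff₀ hg0]
    gcongr
  have hx : 0 ≤ 2 * δ / g₀ := by positivity
  have e : 4 * δ / g₀ = 2 * (2 * δ / g₀) := by ring
  rw [e]
  have hsplit : ∀ a b a' b' : ℝ, a' ≤ a → b ≤ b' →
      γ.real (Set.Ioc a' b') ≤ γ.real (Set.Ioc a b) + ((a - a') + (b' - b)) := by
    intro a b a' b' ha hb
    calc γ.real (Set.Ioc a' b')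
        ≤ γ.real (Set.Ioc a b ∪ (Set.Ioc a' a ∪ Set.Ioc b b')) := by
          refine measureReal_mono fun x hx => ?_
          simp only [Set.mem_union, Set.mem_Ioc] at hx ⊢
          rcases le_or_gt x a with h1 | h1
          · exact .inr (.inl ⟨hx.1, h1⟩)
          · rcases le_or_gt x b with h2 | h2
            · exact .inl ⟨h1, h2⟩
            · exact .inr (.inr ⟨h2, hx.2⟩)
      _ ≤ γ.real (Set.Ioc a b) + (γ.real (Set.Ioc a' a) + γ.real (Set.Ioc b b')) :=
          (measureReal_union_le _ _).trans (by gcongr; exact measureReal_union_le _ _)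
      _ ≤ _ := by gcongr <;> exact gaussianReal_Ioc_le ‹_›
  constructor
  · have h1 := hsplit c c' (c - δ) (c' + δ) (by linarith) (by linarith)
    have h2 : 1 + 2 * δ / g₀ ≤ Real.exp (2 * (2 * δ / g₀)) := by
      linarith [Real.add_one_le_exp (2 * (2 * δ / g₀))]
    have h3 := mul_le_mul_of_nonneg_right h2 (hg0.le.trans hg)
    linarith
  · have h1 := hsplit (c + δ) (c' - δ) c c' (by linarith) (by linarith)
    have h2 := exp_neg_two_mul_le_one_sub hx hδ'
    have h3 := mul_le_mul_of_nonneg_right h2 (hg0.le.trans hg)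
    linarith

/-! ### The conditional law of the angles to a new point -/

/-- The normalized angle in terms of the inner product with `-v`; the sign makes it increasing in
that inner product. -/
theorem normAngle_eq_arcsin (n : ℕ) (v u : SphereAngles.Sph n) :
    SphereAngles.normAngle n v u =
      √(n : ℝ) * Real.arcsin (inner ℝ (-(v : EuclideanSpace ℝ (Fin n))) u) := by
  rw [SphereAngles.normAngle, InnerProductGeometry.angle, norm_eq_of_mem_sphere,
    norm_eq_of_mem_sphere, mul_one, div_one, inner_neg_left, Real.arcsin_neg,
    Real.arccos_eq_pi_div_two_sub_arcsin]
  ring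

theorem abs_inner_le_of_abs_normAngle_le {n : ℕ} (hn : 0 < n) {K : ℝ} {v u : SphereAngles.Sph n}
    (h : |SphereAngles.normAngle n v u| ≤ K) :
    |inner ℝ (v : EuclideanSpace ℝ (Fin n)) u| ≤ K / √n := by
  have hs : 0 < √(n : ℝ) := Real.sqrt_pos.2 (by exact_mod_cast hn)
  rw [normAngle_eq_arcsin, abs_mul, abs_of_pos hs, inner_neg_left, Real.arcsin_neg, abs_neg,
    ← le_div_iff₀' hs] at h
  refine abs_le_of_abs_arcsin_le ?_ h
  simpa using abs_real_inner_le_norm (v : EuclideanSpace ℝ (Fin n)) u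

theorem nat_mul_div_sqrt_le {n k : ℕ} (K : ℝ) (hK : 0 ≤ K) :
    k * (K / √(n : ℝ)) ≤ K * (k ^ 2 / √n) := by
  have : (k : ℝ) ≤ k ^ 2 := by exact_mod_cast Nat.le_self_pow two_ne_zero k
  calc k * (K / √(n : ℝ)) = K * (k / √n) := by ring
    _ ≤ _ := by gcongr

/-- Given `k` points whose mutual normalized angles are bounded by `K`, the normalized angles of a
further uniform point to them behave like `k` independent standard Gaussians, up to a factor
`exp (± C k² / √n)`. -/
theorem exists_conditional_bounds {K ε : ℝ} (hK : 0 < K) (hε : 0 < ε) :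
    ∃ C κ : ℝ, 0 ≤ C ∧ 0 < κ ∧ ∀ n k : ℕ, 4 ≤ n → (k : ℝ) ^ 2 / √n ≤ κ →
      ∀ v : Fin k → SphereAngles.Sph n,
      (∀ i j, i ≠ j → |SphereAngles.normAngle n (v i) (v j)| ≤ K) →
      ∀ c c' : Fin k → ℝ, (∀ i, -K ≤ c i ∧ c' i ≤ K ∧ ε ≤ c' i - c i) →
      Real.exp (-(C * (k ^ 2 / √n))) * ∏ i, (gaussianReal 0 1).real (Set.Ioc (c i) (c' i)) ≤
        (SphereAngles.sphereProb n).real {u | ∀ i, c i < SphereAngles.normAngle n (v i) u ∧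
          SphereAngles.normAngle n (v i) u ≤ c' i} ∧
      (SphereAngles.sphereProb n).real {u | ∀ i, c i < SphereAngles.normAngle n (v i) u ∧
          SphereAngles.normAngle n (v i) u ≤ c' i} ≤
        Real.exp (C * (k ^ 2 / √n)) * ∏ i, (gaussianReal 0 1).real (Set.Ioc (c i) (c' i)) := by
  set g₀ := ε * gaussianPDFReal 0 1 K with hg₀
  have hg0 : 0 < g₀ := mul_pos hε (gaussianPDFReal_pos _ _ _ one_ne_zero)
  set C₁ := K + K * (2 * K) ^ 2 + (2 * K) ^ 4 + 2
  set C₂ := 12 * K ^ 3 / g₀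
  -- The four bounds on `k² / √n` give, in this order: enough dimensions, a Gram matrix close to the
  -- identity, boxes that stay in `[-2K, 2K]` after widening, and a mild change of their measure.
  refine ⟨C₁ + C₂, min (min (1 / 4) (1 / (2 * K))) (min (1 / (3 * K ^ 2)) (g₀ / (12 * K ^ 3))),
    by positivity, by positivity, ?_⟩
  intro n k hn4 hκ v hv c c' hc
  simp only [le_min_iff] at hκ
  obtain ⟨⟨hκ1, hκ2⟩, hκ3, hκ4⟩ := hκ
  have hn0 : (0 : ℝ) < n := by exact_mod_cast (by omega : 0 < n)
  have hs : 0 < √(n : ℝ) := Real.sqrt_pos.2 hn0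
  have : NeZero n := ⟨by omega⟩
  set η := (k : ℝ) ^ 2 / √n with hη
  have hη0 : 0 ≤ η := by positivity
  have hkk : (k : ℝ) ≤ k ^ 2 := by exact_mod_cast Nat.le_self_pow two_ne_zero k
  have hsn : √(n : ℝ) ≤ n := by
    refine (Real.sqrt_le_left hn0.le).2 ?_
    have : (1 : ℝ) ≤ n := by exact_mod_cast (by omega : 1 ≤ n)
    nlinarith
  have hk4 : 4 * k ≤ n := by
    have h1 : (k : ℝ) ^ 2 ≤ 1 / 4 * √n := (div_le_iff₀ hs).1 hκ1
    have : 4 * (k : ℝ) ≤ n := by linarith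
    exact_mod_cast this
  obtain ⟨m, hm⟩ : ∃ m, n = k + m := ⟨n - k, by omega⟩
  have hm2 : 2 ≤ m := by omega
  have : NeZero m := ⟨by omega⟩
  obtain ⟨b, A, hAy, hAA⟩ := exists_orthonormalBasis_coords hm
    (fun i => -(v i : EuclideanSpace ℝ (Fin n)))
  have hdiag : ∀ i, (A * A.transpose) i i = 1 := by
    intro i
    rw [hAA, inner_neg_neg, real_inner_self_eq_norm_sq, norm_eq_of_mem_sphere, one_pow]
  have hoff : ∀ i j, i ≠ j → |(A * A.transpose) i j| ≤ K / √n := by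
    intro i j hij
    rw [hAA, inner_neg_neg]
    exact abs_inner_le_of_abs_normAngle_le (by omega) (hv i j hij)
  have hkK : k * (K / √(n : ℝ)) ≤ 1 / 2 := by
    refine (nat_mul_div_sqrt_le K hK.le).trans ?_
    rw [le_div_iff₀ (by positivity)] at hκ2
    linarith
  obtain ⟨hdet, -, -⟩ := abs_det_bounds (by positivity) hkK hdiag hoff
  set δ := √(n : ℝ) * (K / √n) * (3 * k * (K / √n) ^ 2) with hδdef
  have hδ0 : 0 ≤ δ := by positivity
  have hδ : δ = 3 * K ^ 3 * (k / n) := by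
    rw [hδdef, mul_div_cancel₀ _ hs.ne', div_pow, Real.sq_sqrt hn0.le]; ring
  have hkn : (k : ℝ) ^ 2 / n ≤ η := by rw [hη]; gcongr
  have hkδ : k * δ ≤ 3 * K ^ 3 * η := by
    calc k * δ = 3 * K ^ 3 * (k ^ 2 / n) := by rw [hδ]; ring
      _ ≤ _ := by gcongr
  have hδη : δ ≤ 3 * K ^ 3 * η := by
    rw [hδ]
    gcongr
    exact (div_le_div_of_nonneg_right hkk hn0.le).trans hkn
  have hδK : δ ≤ K := by
    rw [le_div_iff₀ (by positivity)] at hκ3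
    nlinarith
  have hδg : 2 * δ / g₀ ≤ 1 / 2 := by
    rw [div_le_iff₀ hg0]
    rw [le_div_iff₀ (by positivity)] at hκ4
    linarith
  have hcmp : ∀ u : SphereAngles.Sph n, (blockCoords b u).2 ≠ 0 →
      ((∀ i, |SphereAngles.normAngle n (v i) u| ≤ K) ∨
        ∀ i, |(√(n : ℝ) • ‖(blockCoords b u).2‖⁻¹ • A.mulVec (blockCoords b u).1) i| ≤ K) →
      ∀ i, |(√(n : ℝ) • ‖(blockCoords b u).2‖⁻¹ • A.mulVec (blockCoords b u).1) i -
        SphereAngles.normAngle n (v i) u| ≤ δ := by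
    intro u hu h i
    have hns := norm_sq_eq_blockCoords b u
    rw [norm_eq_of_mem_sphere, one_pow] at hns
    have := abs_quotient_sub_arcsin_le (a := √(n : ℝ)) (by positivity) hs.le hkK
      (isUnit_iff_ne_zero.2 hdet) hdiag hoff (norm_pos_iff.2 hu) hns.symm (fun i => by
        rw [hAy]
        simpa using abs_real_inner_le_norm (-(v i : EuclideanSpace ℝ (Fin n))) u)
      (h.imp (fun h i => by
        have := h i
        rwa [normAngle_eq_arcsin, abs_mul, abs_of_pos hs, ← le_div_iff₀' hs, ← hAy] at this)
        (fun h i => by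
        have := h i
        rwa [Pi.smul_apply, Pi.smul_apply, smul_eq_mul, smul_eq_mul, abs_mul, abs_of_pos hs,
          ← le_div_iff₀' hs] at this)) i
    rwa [Pi.smul_apply, Pi.smul_apply, smul_eq_mul, smul_eq_mul, ← mul_assoc,
      normAngle_eq_arcsin, ← hAy]
  have hnull := sphereProb_blockCoords_snd_eq_zero b
  have hnull' : (SphereAngles.sphereProb n).real {u | (blockCoords b u).2 = 0} = 0 := by
    rw [measureReal_def, hnull, ENNReal.toReal_zero]
  have hwid := fun i => gaussianReal_Ioc_widen (K := K) hε hδ0 (hc i).1 (hc i).2.1 (hc i).2.2 hδg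
  have hCk : k * (4 * δ / g₀) ≤ C₂ * η := by
    rw [mul_div_assoc', div_le_iff₀ hg0]
    calc k * (4 * δ) = 4 * (k * δ) := by ring
      _ ≤ 4 * (3 * K ^ 3 * η) := by gcongr
      _ = C₂ * η * g₀ := by simp only [C₂]; field_simp; ring
  constructor
  · have hb := (sphereProb_quotient_box_bounds hm hm2 (by omega) b hK.le
      (by positivity : 0 ≤ 2 * K) hkK hdiag hoff (l := fun i => c i + δ) (r := fun i => c' i - δ)
      (fun i => by linarith [(hc i).1]) (fun i => by linarith [(hc i).2.1])).1
    calc Real.exp (-((C₁ + C₂) * η)) * ∏ i, (gaussianReal 0 1).real (Set.Ioc (c i) (c' i))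
        ≤ Real.exp (-(C₁ * η)) * (Real.exp (-(k * (4 * δ / g₀))) *
            ∏ i, (gaussianReal 0 1).real (Set.Ioc (c i) (c' i))) := by
          rw [← mul_assoc, ← Real.exp_add]
          refine mul_le_mul_of_nonneg_right (Real.exp_le_exp.2 (by linarith))
            (Finset.prod_nonneg fun _ _ => measureReal_nonneg)
      _ = Real.exp (-(C₁ * η)) * ∏ i, (Real.exp (-(4 * δ / g₀)) *
            (gaussianReal 0 1).real (Set.Ioc (c i) (c' i))) := by
          rw [Finset.prod_mul_distrib, Finset.prod_const, Finset.card_univ, Fintype.card_fin,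
            ← Real.exp_nat_mul, mul_neg]
      _ ≤ Real.exp (-(C₁ * η)) *
            ∏ i, (gaussianReal 0 1).real (Set.Ioc (c i + δ) (c' i - δ)) := by
          gcongr with i
          exact (hwid i).2
      _ ≤ _ := hb
      _ ≤ (SphereAngles.sphereProb n).real
            ({u | ∀ i, c i < SphereAngles.normAngle n (v i) u ∧
              SphereAngles.normAngle n (v i) u ≤ c' i} ∪ {u | (blockCoords b u).2 = 0}) := by
          refine measureReal_mono fun u hu => ?_
          by_cases hz : (blockCoords b u).2 = 0
          · exact .inr hz
          · refine .inl fun i => ?_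
            have h1 := abs_le.1 (hcmp u hz (.inr fun j => by
              have := hu j
              exact abs_le.2 ⟨by linarith [this.1, (hc j).1], by linarith [this.2, (hc j).2.1]⟩) i)
            have h2 := hu i
            exact ⟨by linarith [h2.1], by linarith [h2.2]⟩
      _ ≤ _ := by
          refine (measureReal_union_le _ _).trans ?_
          rw [hnull', add_zero]
  · have hb := (sphereProb_quotient_box_bounds hm hm2 (by omega) b hK.le
      (by positivity : 0 ≤ 2 * K) hkK hdiag hoff (l := fun i => c i - δ) (r := fun i => c' i + δ)
      (fun i => by linarith [(hc i).1]) (fun i => by linarith [(hc i).2.1])).2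
    calc (SphereAngles.sphereProb n).real {u | ∀ i, c i < SphereAngles.normAngle n (v i) u ∧
          SphereAngles.normAngle n (v i) u ≤ c' i}
        ≤ (SphereAngles.sphereProb n).real ({u | ∀ i,
            (√(n : ℝ) • ‖(blockCoords b u).2‖⁻¹ • A.mulVec (blockCoords b u).1) i ∈
              Set.Ioc (c i - δ) (c' i + δ)} ∪ {u | (blockCoords b u).2 = 0}) := by
          refine measureReal_mono fun u hu => ?_
          by_cases hz : (blockCoords b u).2 = 0
          · exact .inr hz
          · refine .inl fun i => ?_
            have h1 := abs_le.1 (hcmp u hz (.inl fun j => by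
              have := hu j
              exact abs_le.2 ⟨by linarith [this.1, (hc j).1], by linarith [this.2, (hc j).2.1]⟩) i)
            have h2 := hu i
            exact ⟨by linarith [h2.1], by linarith [h2.2]⟩
      _ ≤ (SphereAngles.sphereProb n).real {u | ∀ i,
            (√(n : ℝ) • ‖(blockCoords b u).2‖⁻¹ • A.mulVec (blockCoords b u).1) i ∈
              Set.Ioc (c i - δ) (c' i + δ)} := by
          refine (measureReal_union_le _ _).trans ?_
          rw [hnull', add_zero]
      _ ≤ _ := hb
      _ ≤ Real.exp (C₁ * η) * ∏ i, (Real.exp (4 * δ / g₀) *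
            (gaussianReal 0 1).real (Set.Ioc (c i) (c' i))) := by
          gcongr with i
          exact (hwid i).1
      _ = Real.exp (C₁ * η) * (Real.exp (k * (4 * δ / g₀)) *
            ∏ i, (gaussianReal 0 1).real (Set.Ioc (c i) (c' i))) := by
          rw [Finset.prod_mul_distrib, Finset.prod_const, Finset.card_univ, Fintype.card_fin,
            ← Real.exp_nat_mul]
      _ ≤ _ := by
          rw [← mul_assoc, ← Real.exp_add]
          refine mul_le_mul_of_nonneg_right (Real.exp_le_exp.2 (by linarith))
            (Finset.prod_nonneg fun _ _ => measureReal_nonneg)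

/-! ### Induction on the number of points -/

theorem measurable_normAngle {α : Type*} [MeasurableSpace α] {n : ℕ}
    {f g : α → SphereAngles.Sph n} (hf : Measurable f) (hg : Measurable g) :
    Measurable fun a => SphereAngles.normAngle n (f a) (g a) := by
  simp only [normAngle_eq_arcsin]
  exact (Real.measurable_arcsin.comp (hf.subtype_val.neg.inner hg.subtype_val)).const_mul _

theorem normAngle_comm (n : ℕ) (u v : SphereAngles.Sph n) :
    SphereAngles.normAngle n u v = SphereAngles.normAngle n v u := by
  rw [SphereAngles.normAngle, InnerProductGeometry.angle_comm, SphereAngles.normAngle]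

theorem prod_pairs_succ (f : ℕ → ℕ → ℝ) (N : ℕ) :
    ∏ p : SphereAngles.Pairs (N + 1), f p.1.1 p.1.2 =
      (∏ p : SphereAngles.Pairs N, f p.1.1 p.1.2) * ∏ i : Fin N, f i N := by
  have h : ∀ M : ℕ, ∏ p : SphereAngles.Pairs M, f p.1.1 p.1.2 =
      ∏ i : Fin M, ∏ j : Fin M, if i < j then f i j else 1 := by
    intro M
    rw [← Fintype.prod_prod_type' (fun i j : Fin M => if i < j then f i j else 1),
      ← Finset.prod_filter]
    exact (Finset.prod_subtype _ (by simp) fun p : Fin M × Fin M => f p.1 p.2).symm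
  rw [h, h, Fin.prod_univ_castSucc]
  simp only [Fin.prod_univ_castSucc, Fin.castSucc_lt_castSucc_iff, Fin.castSucc_lt_last, if_true,
    Fin.val_castSucc, Fin.val_last, lt_irrefl, if_false, (Fin.castSucc_lt_last _).not_gt,
    Finset.prod_const_one, mul_one, Finset.prod_mul_distrib]

theorem gaussProb_succ (K : ℝ) (N : ℕ) (c c' : ℕ → ℕ → ℝ)
    (h : ∀ i j, i < j → -K ≤ c i j ∧ c' i j ≤ K) :
    SphereAngles.gaussProb K (N + 1) c c' = SphereAngles.gaussProb K N c c' *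
      ∏ i : Fin N, (gaussianReal 0 1).real (Set.Ioc (c i N) (c' i N)) := by
  rw [SphereAngles.gaussProb_eq K _ c c' h, SphereAngles.gaussProb_eq K _ c c' h]
  simp only [measureReal_def, Measure.pi_pi, ENNReal.toReal_prod]
  exact prod_pairs_succ
    (fun i j => ((gaussianReal 0 1) (Set.Ioc (c i j) (c' i j))).toReal) N

/-- Fubini: bounds for the conditional probability of the constraints on the last point, given the
others, carry over to `angleProb`. -/
theorem angleProb_succ_bounds {n N : ℕ} [NeZero n] {K : ℝ} {c c' : ℕ → ℕ → ℝ}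
    (hc : ∀ i j, i < j → -K ≤ c i j ∧ c' i j ≤ K) {lo hi : ℝ} (hhi : 0 ≤ hi)
    (h : ∀ v : Fin N → SphereAngles.Sph n,
      (∀ i j, i ≠ j → |SphereAngles.normAngle n (v i) (v j)| ≤ K) →
      lo ≤ (SphereAngles.sphereProb n).real {u | ∀ i : Fin N,
          c i N < SphereAngles.normAngle n (v i) u ∧ SphereAngles.normAngle n (v i) u ≤ c' i N} ∧
        (SphereAngles.sphereProb n).real {u | ∀ i : Fin N,
          c i N < SphereAngles.normAngle n (v i) u ∧
            SphereAngles.normAngle n (v i) u ≤ c' i N} ≤ hi) :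
    lo * SphereAngles.angleProb n N c c' ≤ SphereAngles.angleProb n (N + 1) c c' ∧
      SphereAngles.angleProb n (N + 1) c c' ≤ hi * SphereAngles.angleProb n N c c' := by
  set σ := SphereAngles.sphereProb n
  set ν := Measure.pi fun _ : Fin N => σ
  set E : Set (Fin N → SphereAngles.Sph n) := {u | ∀ i j : Fin N, i < j →
      c i j < SphereAngles.normAngle n (u i) (u j) ∧
        SphereAngles.normAngle n (u i) (u j) ≤ c' i j} with hE
  set F : (Fin N → SphereAngles.Sph n) → Set (SphereAngles.Sph n) := fun v => {u | ∀ i : Fin N,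
      c i N < SphereAngles.normAngle n (v i) u ∧ SphereAngles.normAngle n (v i) u ≤ c' i N} with hF
  have hEm : MeasurableSet E := by
    simp only [hE, Set.ofPred_forall]
    refine .iInter fun i => .iInter fun j => .iInter fun _ => ?_
    exact measurable_normAngle (measurable_pi_apply i) (measurable_pi_apply j) measurableSet_Ioc
  set S : Set (SphereAngles.Sph n × (Fin N → SphereAngles.Sph n)) :=
    {p | p.2 ∈ E ∧ p.1 ∈ F p.2} with hS
  have hSm : MeasurableSet S := by
    refine (measurable_snd hEm).inter ?_
    have : {p : SphereAngles.Sph n × (Fin N → SphereAngles.Sph n) | p.1 ∈ F p.2} =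
        ⋂ i : Fin N, {p | SphereAngles.normAngle n (p.2 i) p.1 ∈ Set.Ioc (c i N) (c' i N)} := by
      ext p; simp [hF]
    change MeasurableSet {p : SphereAngles.Sph n × (Fin N → SphereAngles.Sph n) | p.1 ∈ F p.2}
    rw [this]
    refine .iInter fun i => ?_
    exact measurable_normAngle ((measurable_pi_apply i).comp measurable_snd) measurable_fst
      measurableSet_Ioc
  have hmp := measurePreserving_piFinSuccAbove (fun _ : Fin (N + 1) => σ) (Fin.last N)
  have hpre : {u : Fin (N + 1) → SphereAngles.Sph n | ∀ i j : Fin (N + 1), i < j →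
      c i j < SphereAngles.normAngle n (u i) (u j) ∧
        SphereAngles.normAngle n (u i) (u j) ≤ c' i j} =
      MeasurableEquiv.piFinSuccAbove (fun _ => SphereAngles.Sph n) (Fin.last N) ⁻¹' S := by
    ext u
    simp only [hS, hE, hF, Set.mem_preimage, Set.mem_ofPred_eq, MeasurableEquiv.piFinSuccAbove]
    constructor
    · intro h
      exact ⟨fun i j hij => by simpa [Fin.init] using h i.castSucc j.castSucc (by simpa [Fin.init] using hij),
        fun i => by simpa [Fin.init] using h i.castSucc (Fin.last N) (Fin.castSucc_lt_last i)⟩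
    · rintro ⟨h1, h2⟩ i j hij
      induction j using Fin.lastCases with
      | last =>
        induction i using Fin.lastCases with
        | last => exact absurd hij (lt_irrefl _)
        | cast i => simpa [Fin.init] using h2 i
      | cast j =>
        induction i using Fin.lastCases with
        | last => exact absurd hij (Fin.castSucc_lt_last j).not_gt
        | cast i => simpa [Fin.init] using h1 i j (by simpa [Fin.init] using hij)
  have hprob : (Measure.pi fun _ : Fin (N + 1) => σ)
      {u : Fin (N + 1) → SphereAngles.Sph n | ∀ i j : Fin (N + 1), i < j →
        c i j < SphereAngles.normAngle n (u i) (u j) ∧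
          SphereAngles.normAngle n (u i) (u j) ≤ c' i j} = ∫⁻ v in E, σ (F v) ∂ν := by
    rw [hpre, hmp.measure_preimage_equiv, Measure.prod_apply_symm hSm, ← lintegral_indicator hEm]
    refine lintegral_congr fun v => ?_
    by_cases hv : v ∈ E
    · rw [Set.indicator_of_mem hv]
      congr 1
      ext u
      simp [hS, hv]
    · rw [Set.indicator_of_notMem hv]
      convert measure_empty (μ := σ)
      ext u
      simp [hS, hv]
  have hK : ∀ v ∈ E, ∀ i j, i ≠ j → |SphereAngles.normAngle n (v i) (v j)| ≤ K := by
    intro v hv i j hij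
    wlog hlt : i < j generalizing i j
    · rw [normAngle_comm]
      exact this j i hij.symm (lt_of_le_of_ne (not_lt.1 hlt) hij.symm)
    · have h1 := hv i j hlt
      have h2 := hc i j hlt
      exact abs_le.2 ⟨h2.1.trans h1.1.le, h1.2.trans h2.2⟩
  simp only [SphereAngles.angleProb, measureReal_def]
  rw [hprob]
  change lo * (ν E).toReal ≤ _ ∧ _ ≤ hi * (ν E).toReal
  have hub : ∫⁻ v in E, σ (F v) ∂ν ≤ ENNReal.ofReal hi * ν E := by
    rw [← setLIntegral_const]
    refine setLIntegral_mono' hEm fun v hv => ?_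
    exact (ENNReal.le_ofReal_iff_toReal_le (measure_ne_top _ _) hhi).2 (h v (hK v hv)).2
  have hlb : ENNReal.ofReal lo * ν E ≤ ∫⁻ v in E, σ (F v) ∂ν := by
    rw [← setLIntegral_const]
    refine setLIntegral_mono' hEm fun v hv => ?_
    exact (ENNReal.ofReal_le_iff_le_toReal (measure_ne_top _ _)).2 (h v (hK v hv)).1
  have hfin : ENNReal.ofReal hi * ν E ≠ ⊤ :=
    ENNReal.mul_ne_top ENNReal.ofReal_ne_top (measure_ne_top _ _)
  constructor
  · refine le_trans ?_ (ENNReal.toReal_mono (ne_top_of_le_ne_top hfin hub) hlb)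
    rw [ENNReal.toReal_mul]
    gcongr
    exact (le_max_left lo 0).trans_eq ENNReal.toReal_ofReal'.symm
  · refine (ENNReal.toReal_mono hfin hub).trans_eq ?_
    rw [ENNReal.toReal_mul, ENNReal.toReal_ofReal hhi]

theorem exists_angleProb_bounds {K ε : ℝ} (hK : 0 < K) (hε : 0 < ε) :
    ∃ C κ : ℝ, 0 ≤ C ∧ 0 < κ ∧ ∀ n N : ℕ, 4 ≤ n → (N : ℝ) ^ 2 / √n ≤ κ →
      ∀ c c' : ℕ → ℕ → ℝ, (∀ i j, i < j → -K ≤ c i j ∧ c' i j ≤ K ∧ ε ≤ c' i j - c i j) →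
      Real.exp (-(C * (N ^ 3 / √n))) * SphereAngles.gaussProb K N c c' ≤
        SphereAngles.angleProb n N c c' ∧
      SphereAngles.angleProb n N c c' ≤
        Real.exp (C * (N ^ 3 / √n)) * SphereAngles.gaussProb K N c c' := by
  obtain ⟨C, κ, hC, hκ, hstep⟩ := exists_conditional_bounds hK hε
  refine ⟨C, κ, hC, hκ, fun n N hn4 hN c c' hc => ?_⟩
  have : NeZero n := ⟨by omega⟩
  have hc2 : ∀ i j, i < j → -K ≤ c i j ∧ c' i j ≤ K := fun i j hij =>
    ⟨(hc i j hij).1, (hc i j hij).2.1⟩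
  have hG : ∀ M, 0 ≤ SphereAngles.gaussProb K M c c' := fun M => by
    rw [SphereAngles.gaussProb_eq K M c c' hc2]; exact measureReal_nonneg
  have hP : ∀ M, 0 ≤ SphereAngles.angleProb n M c c' := fun M => measureReal_nonneg
  set η := (N : ℝ) ^ 2 / √n with hη
  -- The bound `k² ≤ N²` in every step already yields the order `N · N²` of the total error.
  have main : ∀ M : ℕ, M ≤ N →
      Real.exp (-(M * (C * η))) * SphereAngles.gaussProb K M c c' ≤
        SphereAngles.angleProb n M c c' ∧
      SphereAngles.angleProb n M c c' ≤
        Real.exp (M * (C * η)) * SphereAngles.gaussProb K M c c' := by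
    intro M
    induction M with
    | zero =>
      intro _
      have h1 : SphereAngles.angleProb n 0 c c' = 1 := by
        simp [SphereAngles.angleProb]
      have h2 : SphereAngles.gaussProb K 0 c c' = 1 := by
        rw [SphereAngles.gaussProb_eq K 0 c c' hc2, measureReal_def, Measure.pi_pi]
        simp
      simp [h1, h2]
    | succ M ih =>
      intro hM
      obtain ⟨ih1, ih2⟩ := ih (by omega)
      have hMη : (M : ℝ) ^ 2 / √n ≤ η := by
        have : (M : ℝ) ≤ N := by exact_mod_cast (by omega : M ≤ N)
        rw [hη]; gcongr
      set g := ∏ i : Fin M, (gaussianReal 0 1).real (Set.Ioc (c i M) (c' i M)) with hg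
      have hg0 : 0 ≤ g := Finset.prod_nonneg fun _ _ => measureReal_nonneg
      have hb := angleProb_succ_bounds (n := n) (N := M) hc2
        (lo := Real.exp (-(C * η)) * g) (hi := Real.exp (C * η) * g) (by positivity) fun v hv => by
          have := hstep n M hn4 (hMη.trans hN) v hv (fun i => c i M) (fun i => c' i M)
            fun i => hc i M i.2
          refine ⟨le_trans ?_ this.1, this.2.trans ?_⟩ <;> gcongr
      rw [gaussProb_succ K M c c' hc2, ← hg]
      constructor
      · calc _ = Real.exp (-(C * η)) * g *
              (Real.exp (-(M * (C * η))) * SphereAngles.gaussProb K M c c') := by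
              push_cast
              rw [show -((M + 1 : ℝ) * (C * η)) = -(C * η) + -(M * (C * η)) by ring, Real.exp_add]
              ring
          _ ≤ _ := mul_le_mul_of_nonneg_left ih1 (by positivity)
          _ ≤ _ := hb.1
      · calc _ ≤ _ := hb.2
          _ ≤ Real.exp (C * η) * g *
              (Real.exp (M * (C * η)) * SphereAngles.gaussProb K M c c') :=
              mul_le_mul_of_nonneg_left ih2 (by positivity)
          _ = _ := by
              push_cast
              rw [show (M + 1 : ℝ) * (C * η) = C * η + M * (C * η) by ring, Real.exp_add]
              ring
  have e : C * (N ^ 3 / √n) = N * (C * η) := by rw [hη]; ring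
  rw [e]
  exact main N le_rfl

theorem gaussProb_pos {K : ℝ} {c c' : ℕ → ℕ → ℝ} (N : ℕ)
    (h : ∀ i j, i < j → -K ≤ c i j ∧ c i j < c' i j ∧ c' i j ≤ K) :
    0 < SphereAngles.gaussProb K N c c' := by
  rw [SphereAngles.gaussProb_eq K N c c' fun i j hij => ⟨(h i j hij).1, (h i j hij).2.2⟩,
    measureReal_def, Measure.pi_pi, ENNReal.toReal_prod]
  refine Finset.prod_pos fun p _ => ?_
  obtain ⟨h1, h2, h3⟩ := h p.1.1 p.1.2 p.2
  exact (mul_pos (sub_pos.2 h2) (gaussianPDFReal_pos _ _ _ one_ne_zero)).trans_le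
    (le_gaussianReal_Ioc h1 h3 h2.le)

theorem eventually_cube_div_sqrt_le {N : ℕ → ℕ}
    (hN : (fun n : ℕ => (N n : ℝ)) =o[atTop] (fun n : ℕ => (n : ℝ) ^ (1 / 6 : ℝ)))
    {κ : ℝ} (hκ : 0 < κ) : ∀ᶠ n : ℕ in atTop, (N n : ℝ) ^ 3 / √n ≤ κ := by
  have hmin : 0 < min κ 1 := lt_min hκ one_pos
  filter_upwards [hN.def hmin, eventually_gt_atTop 0] with n hn hn0
  have hn0' : (0 : ℝ) < n := by exact_mod_cast hn0
  rw [Real.norm_of_nonneg (by positivity), Real.norm_of_nonneg (by positivity)] at hn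
  have hpow : ((n : ℝ) ^ (1 / 6 : ℝ)) ^ 3 = √n := by
    rw [Real.sqrt_eq_rpow, ← Real.rpow_natCast, ← Real.rpow_mul hn0'.le]
    norm_num
  rw [div_le_iff₀ (Real.sqrt_pos.2 hn0')]
  calc (N n : ℝ) ^ 3 ≤ (min κ 1 * (n : ℝ) ^ (1 / 6 : ℝ)) ^ 3 := by gcongr
    _ = min κ 1 ^ 3 * √n := by rw [mul_pow, hpow]
    _ ≤ κ * √n := by
        gcongr
        calc min κ 1 ^ 3 ≤ min κ 1 := pow_le_of_le_one hmin.le (min_le_right _ _) three_ne_zero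
          _ ≤ κ := min_le_left _ _

theorem abs_div_sub_one_le_of_exp_bounds {p g x : ℝ} (hg : 0 < g) (hx : 0 ≤ x) (hx1 : x ≤ 1)
    (hl : Real.exp (-x) * g ≤ p) (hu : p ≤ Real.exp x * g) : |p / g - 1| ≤ 2 * x := by
  have h1 : Real.exp (-x) ≤ p / g := (le_div_iff₀ hg).2 hl
  have h2 : p / g ≤ Real.exp x := (div_le_iff₀ hg).2 hu
  have h3 := abs_le.1 (Real.abs_exp_sub_one_le (x := x) (by rwa [abs_of_nonneg hx]))
  have h4 := Real.add_one_le_exp (-x)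
  rw [abs_of_nonneg hx] at h3
  exact abs_le.2 ⟨by linarith, by linarith [h3.2]⟩

theorem theorem2p1 (K : ℝ) (hK : 0 < K) (ε : ℝ) (hε : 0 < ε) :
    ∃ C : ℝ, ∀ N : ℕ → ℕ,
      (fun n : ℕ => (N n : ℝ)) =o[atTop] (fun n : ℕ => (n : ℝ) ^ (1 / 6 : ℝ)) →
      ∀ᶠ n : ℕ in atTop, ∀ c c' : ℕ → ℕ → ℝ,
        (∀ i j : ℕ, i < j → -K ≤ c i j ∧ c i j < c' i j ∧ c' i j ≤ K ∧ ε ≤ c' i j - c i j) →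
        |SphereAngles.angleProb n (N n) c c' / SphereAngles.gaussProb K (N n) c c' - 1|
          ≤ C * ((N n : ℝ) ^ 3 / √(n : ℝ)) := by
  obtain ⟨C, κ, hC, hκ, h⟩ := exists_angleProb_bounds hK hε
  refine ⟨2 * C, fun N hN => ?_⟩
  filter_upwards [eventually_cube_div_sqrt_le hN hκ,
    eventually_cube_div_sqrt_le hN (show 0 < 1 / (C + 1) by positivity), eventually_ge_atTop 4]
    with n h1 h2 hn4 c c' hc
  have h23 : (N n : ℝ) ^ 2 ≤ (N n : ℝ) ^ 3 := by
    rcases Nat.eq_zero_or_pos (N n) with h0 | h0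
    · simp [h0]
    · exact_mod_cast Nat.pow_le_pow_right h0 (by norm_num)
  have hb := h n (N n) hn4 ((div_le_div_of_nonneg_right h23 (Real.sqrt_nonneg _)).trans h1) c c'
    fun i j hij => ⟨(hc i j hij).1, (hc i j hij).2.2⟩
  have hx1 : C * ((N n : ℝ) ^ 3 / √n) ≤ 1 := by
    rw [le_div_iff₀ (by positivity)] at h2
    have : 0 ≤ (N n : ℝ) ^ 3 / √n := by positivity
    linarith
  rw [mul_assoc]
  exact abs_div_sub_one_le_of_exp_bounds
    (gaussProb_pos _ fun i j hij => ⟨(hc i j hij).1, (hc i j hij).2.1, (hc i j hij).2.2.1⟩)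
    (by positivity) hx1 hb.1 hb.2
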